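/- All symmetric monoidal categories are small. For symmetric monoidal categories $\mathcal A,\mathcal B$, a symmetric monoidal functor $F:\mathcal A\to\mathcal B$ is a functor with natural arrows $F^0:I\to F(I)$ and $F^2_{a,a'}:F(a)\otimes F(a')\to F(a\otimes a')$ (not assumed invertible) compatible with the associativity, unit and symmetry constraints; it is called strong if $F^0$ and all $F^2_{a,a'}$ are isomorphisms, and strict if they are all identities. With monoidal natural transformations as 2-cells, the symmetric monoidal categories form a 2-category $SMC$. The category $SMC(\mathcal A,\mathcal B)$ carries a pointwise symmetric monoidal structure, denoted $[\mathcal A,\mathcal B]$: its unit is the constant functor at $I$ and $(F\Box G)(a)=F(a)\otimes G(a)$, with the evident monoidal structures on these functors. The tensor product $\mathcal A\otimes\mathcal B$ is the symmetric monoidal category whose objects are the words freely generated from the symbols $a\otimes b$ ($a\in\mathcal A$, $b\in\mathcal B$) by a constant $I$ and a binary operation $\otimes$. Its arrows are generated, under composition and tensoring with objects, by the canonical arrows (associativity, units, symmetry), by $f\otimes b:a\otimes b\to a'\otimes b$ and $a\otimes g:a\otimes b\to a\otimes b'$ for $f:a\to a'$ in $\mathcal A$ and $g:b\to b'$ in $\mathcal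 B$, and by arrows $$\alpha_b:I\to I_{\mathcal A}\otimes b,\quad \beta_a:I\to a\otimes I_{\mathcal B},\quad \gamma_{a,a',b}:(a\otimes b)\otimes(a'\otimes b)\to(a\otimes a')\otimes b,\quad \delta_{a,b,b'}:(a\otimes b)\otimes(a\otimes b')\to a\otimes(b\otimes b').$$ They are subject to the axioms of a symmetric monoidal category and to exactly those relations which say that $\eta(a):=a\otimes-$, with $\eta(a)^0=\beta_a$ and $\eta(a)^2=\delta_{a,-,-}$, is a symmetric monoidal functor $\mathcal B\to\mathcal A\otimes\mathcal B$ for each $a$, that $\eta(f):=f\otimes-$ is a monoidal natural transformation for each $f$, and that $a\mapsto\eta(a)$, with $(\eta^0)_b=\alpha_b$ and $(\eta^2_{a,a'})_b=\gamma_{a,a',b}$, is a symmetric monoidal functor $\eta:\mathcal A\to[\mathcal B,\mathcal A\otimes\mathcal B]$. Let $Rn:[\mathcal A\otimes\mathcal B,\mathcal C]\to[\mathcal A,[\mathcal B,\mathcal C]]$ be the composite symmetric monoidal functor $$[\mathcal A\otimes\mathcal B,\mathcal C]\xrightarrow{[\mathcal B,-]}[[\mathcal B,\mathcal A\otimes\mathcal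 B],[\mathcal B,\mathcal C]]\xrightarrow{[\eta,1]}[\mathcal A,[\mathcal B,\mathcal C]].$$ Here $[\mathcal B,-]$ sends $F$ to post-composition with $F$ (whose monoidal structure is given pointwise by $F^0$ and $F^2$), $[\eta,1]$ is pre-composition with $\eta$, and the monoidal structures of $[\mathcal B,-]$ and $[\eta,1]$ consist of identities. Let $En:SMC(\mathcal A,[\mathcal B,\mathcal C])\to SMC(\mathcal A\otimes\mathcal B,\mathcal C)$ be the functor sending $F$ to the strict symmetric monoidal functor $En(F)$ with $En(F)(I)=I$, $En(F)(a\otimes b)=F(a)(b)$, $En(F)(X\otimes Y)=En(F)(X)\otimes En(F)(Y)$, which sends $f\otimes b$, $a\otimes g$, $\alpha_b$, $\beta_a$, $\gamma_{a,a',b}$, $\delta_{a,b,b'}$ to $F(f)_b$, $F(a)(g)$, $(F^0)_b$, $F(a)^0$, $(F^2_{a,a'})_b$, $F(a)^2_{b,b'}$, respectively. It sends $\sigma:F\to G$ to $En(\sigma)$ with $En(\sigma)_I=1$, $En(\sigma)_{a\otimes b}=(\sigma_a)_b$ and $En(\sigma)_{X\otimes Y}=En(\sigma)_X\otimes En(\sigma)_Y$.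 **Proposition.** Let $\mathcal A,\mathcal B,\mathcal C$ be small symmetric monoidal categories. 1. The symmetric monoidal functor $Rn$ is strict. 2. In $\mathbf{Cat}$, $En$ is left adjoint to $Rn$. The unit of the adjunction is the identity; in particular $Rn\circ En=1$. Its counit $\epsilon_F:En(Rn(F))\to F$, for $F:\mathcal A\otimes\mathcal B\to\mathcal C$, has the components $(\epsilon_F)_{a\otimes b}=1$, $(\epsilon_F)_I=F^0$ and $(\epsilon_F)_{X\otimes Y}=F^2_{X,Y}\circ((\epsilon_F)_X\otimes(\epsilon_F)_Y)$. If $F$ is strict then $En(Rn(F))=F$ and $\epsilon_F$ is the identity; if $F$ is strong then $\epsilon_F$ is an isomorphism. 3. The functor $En$ admits a symmetric monoidal structure for which there is an adjunction $En\dashv Rn:[\mathcal A\otimes\mathcal B,\mathcal C]\to[\mathcal A,[\mathcal B,\mathcal C]]$ in the 2-category $SMC$ whose unit and counit have the adjunction of (2) as underlying adjunction in $\mathbf{Cat}$; its unit is the identity 2-cell $1=Rn\circ En$. -/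

import Mathlib

open CategoryTheory MonoidalCategory Functor.LaxMonoidal
universe u
set_option linter.unusedSimpArgs false
set_option linter.unusedSectionVars false
set_option linter.unusedVariables false

/-- Small symmetric monoidal categories. -/
structure SymMonCat : Type (u + 1) where
  /-- the objects -/
  carrier : Type u
  [category : SmallCategory carrier]
  [monoidal : MonoidalCategory carrier]
  [symmetric : SymmetricCategory carrier]

namespace SymMonCat

instance : CoeSort SymMonCat.{u} (Type u) := ⟨carrier⟩

attribute [instance] category monoidal symmetric

section Cells

variable {A B C D : Type u} [SmallCategory A] [MonoidalCategory A] [SymmetricCategory A]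
  [SmallCategory B] [MonoidalCategory B] [SymmetricCategory B]
  [SmallCategory C] [MonoidalCategory C] [SymmetricCategory C]
  [SmallCategory D] [MonoidalCategory D] [SymmetricCategory D]

/-- The component at `a` of a monoidal natural transformation `σ : F ⟶ G`. -/
def app₂ {F G : LaxBraidedFunctor A B} (σ : F ⟶ G) (a : A) : F.obj a ⟶ G.obj a :=
  σ.hom.hom.app a

/-- A monoidal natural transformation from its components. -/
def mk₂ {F G : LaxBraidedFunctor A B} (app : ∀ a, F.obj a ⟶ G.obj a)
    (nat : ∀ {a a' : A} (f : a ⟶ a'), F.map f ≫ app a' = app a ≫ G.map f)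
    (unit : ε F.toFunctor ≫ app (𝟙_ A) = ε G.toFunctor)
    (tensor : ∀ a a', μ F.toFunctor a a' ≫ app (a ⊗ a') =
      (app a ⊗ₘ app a') ≫ μ G.toFunctor a a') : F ⟶ G :=
  haveI : NatTrans.IsMonoidal (⟨app, fun _ _ f => nat f⟩ : F.toFunctor ⟶ G.toFunctor) :=
    ⟨unit, tensor⟩
  LaxBraidedFunctor.homMk ⟨app, fun _ _ f => nat f⟩

@[simp] lemma app₂_mk₂ {F G : LaxBraidedFunctor A B} (app nat unit tensor) (a : A) :
    app₂ (mk₂ (F := F) (G := G) app nat unit tensor) a = app a := rfl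

@[ext] lemma ext₂ {F G : LaxBraidedFunctor A B} {σ τ : F ⟶ G}
    (h : ∀ a, app₂ σ a = app₂ τ a) : σ = τ :=
  LaxBraidedFunctor.hom_ext (NatTrans.ext (funext h))

@[simp] lemma app₂_id (F : LaxBraidedFunctor A B) (a : A) : app₂ (𝟙 F) a = 𝟙 (F.obj a) := rfl

@[simp] lemma app₂_comp {F G H : LaxBraidedFunctor A B} (σ : F ⟶ G) (τ : G ⟶ H) (a : A) :
    app₂ (σ ≫ τ) a = app₂ σ a ≫ app₂ τ a := rfl

@[simp] lemma app₂_hom_inv {F G : LaxBraidedFunctor A B} (e : F ≅ G) (a : A) :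
    app₂ e.hom a ≫ app₂ e.inv a = 𝟙 _ := by rw [← app₂_comp]; simp

@[simp] lemma app₂_hom_inv_assoc {F G : LaxBraidedFunctor A B} (e : F ≅ G) (a : A) {X : B}
    (h : F.obj a ⟶ X) : app₂ e.hom a ≫ app₂ e.inv a ≫ h = h := by
  rw [← Category.assoc, app₂_hom_inv, Category.id_comp]

@[simp] lemma app₂_inv_hom {F G : LaxBraidedFunctor A B} (e : F ≅ G) (a : A) :
    app₂ e.inv a ≫ app₂ e.hom a = 𝟙 _ := by rw [← app₂_comp]; simp

@[simp] lemma app₂_inv_hom_assoc {F G : LaxBraidedFunctor A B} (e : F ≅ G) (a : A) {X : B}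
    (h : G.obj a ⟶ X) : app₂ e.inv a ≫ app₂ e.hom a ≫ h = h := by
  rw [← Category.assoc, app₂_inv_hom, Category.id_comp]

lemma nat₂ {F G : LaxBraidedFunctor A B} (σ : F ⟶ G) {a a' : A} (f : a ⟶ a') :
    F.map f ≫ app₂ σ a' = app₂ σ a ≫ G.map f := σ.hom.hom.naturality f

lemma nat₂_assoc {F G : LaxBraidedFunctor A B} (σ : F ⟶ G) {a a' : A} (f : a ⟶ a') {X : B}
    (h : G.obj a' ⟶ X) : F.map f ≫ app₂ σ a' ≫ h = app₂ σ a ≫ G.map f ≫ h := by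
  rw [← Category.assoc, nat₂, Category.assoc]

lemma unit₂ {F G : LaxBraidedFunctor A B} (σ : F ⟶ G) :
    ε F.toFunctor ≫ app₂ σ (𝟙_ A) = ε G.toFunctor := σ.hom.isMonoidal.unit

lemma unit₂_assoc {F G : LaxBraidedFunctor A B} (σ : F ⟶ G) {X : B} (h : G.obj (𝟙_ A) ⟶ X) :
    ε F.toFunctor ≫ app₂ σ (𝟙_ A) ≫ h = ε G.toFunctor ≫ h := by
  rw [← Category.assoc, unit₂]

lemma tensor₂ {F G : LaxBraidedFunctor A B} (σ : F ⟶ G) (a a' : A) :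
    μ F.toFunctor a a' ≫ app₂ σ (a ⊗ a') =
      (app₂ σ a ⊗ₘ app₂ σ a') ≫ μ G.toFunctor a a' := σ.hom.isMonoidal.tensor a a'

lemma tensor₂_assoc {F G : LaxBraidedFunctor A B} (σ : F ⟶ G) (a a' : A) {X : B}
    (h : G.obj (a ⊗ a') ⟶ X) : μ F.toFunctor a a' ≫ app₂ σ (a ⊗ a') ≫ h =
      (app₂ σ a ⊗ₘ app₂ σ a') ≫ μ G.toFunctor a a' ≫ h := by
  rw [← Category.assoc, tensor₂, Category.assoc]

/-- An invertible monoidal natural transformation from its components. -/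
def iso₂ {F G : LaxBraidedFunctor A B} (app : ∀ a, F.obj a ≅ G.obj a)
    (nat : ∀ {a a' : A} (f : a ⟶ a'), F.map f ≫ (app a').hom = (app a).hom ≫ G.map f)
    (unit : ε F.toFunctor ≫ (app (𝟙_ A)).hom = ε G.toFunctor)
    (tensor : ∀ a a', μ F.toFunctor a a' ≫ (app (a ⊗ a')).hom =
      ((app a).hom ⊗ₘ (app a').hom) ≫ μ G.toFunctor a a') : F ≅ G where
  hom := mk₂ (fun a => (app a).hom) nat unit tensor
  inv := mk₂ (fun a => (app a).inv)
    (fun {a a'} f => by rw [Iso.comp_inv_eq, Category.assoc, nat, Iso.inv_hom_id_assoc])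
    (by rw [Iso.comp_inv_eq, unit])
    (fun a a' => by
      rw [Iso.comp_inv_eq, Category.assoc, tensor, tensorHom_comp_tensorHom_assoc]; simp)
  hom_inv_id := by ext a; simp
  inv_hom_id := by ext a; simp

@[simp] lemma app₂_iso₂_hom {F G : LaxBraidedFunctor A B} (app nat unit tensor) (a : A) :
    app₂ (iso₂ (F := F) (G := G) app nat unit tensor).hom a = (app a).hom := rfl

@[simp] lemma app₂_iso₂_inv {F G : LaxBraidedFunctor A B} (app nat unit tensor) (a : A) :
    app₂ (iso₂ (F := F) (G := G) app nat unit tensor).inv a = (app a).inv := rfl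

/-- The identity symmetric monoidal functor. -/
abbrev id₁ (A : Type u) [SmallCategory A] [MonoidalCategory A] [SymmetricCategory A] :
    LaxBraidedFunctor A A :=
  ⟨𝟭 A, inferInstance⟩

/-- The composite of symmetric monoidal functors. -/
abbrev comp₁ (F : LaxBraidedFunctor A B) (G : LaxBraidedFunctor B C) : LaxBraidedFunctor A C :=
  ⟨F.toFunctor ⋙ G.toFunctor, inferInstance⟩

/-- Whiskering of a monoidal natural transformation by a symmetric monoidal functor. -/
def whiskerLeft₂ (F : LaxBraidedFunctor A B) {G H : LaxBraidedFunctor B C} (σ : G ⟶ H) :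
    comp₁ F G ⟶ comp₁ F H :=
  mk₂ (fun a => app₂ σ (F.obj a)) (fun f => nat₂ σ (F.map f))
    (by simp [comp_ε, nat₂, unit₂_assoc])
    (fun a a' => by simp [comp_μ, nat₂, tensor₂_assoc])

/-- Whiskering of a monoidal natural transformation by a symmetric monoidal functor. -/
def whiskerRight₂ {F G : LaxBraidedFunctor A B} (σ : F ⟶ G) (H : LaxBraidedFunctor B C) :
    comp₁ F H ⟶ comp₁ G H :=
  mk₂ (fun a => H.map (app₂ σ a)) (fun f => by simp [← Functor.map_comp, nat₂])
    (by simp [comp_ε, ← Functor.map_comp, unit₂])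
    (fun a a' => by simp [comp_μ, ← Functor.map_comp, tensor₂, μ_natural_assoc])

@[simp] lemma app₂_whiskerLeft₂ (F : LaxBraidedFunctor A B) {G H : LaxBraidedFunctor B C}
    (σ : G ⟶ H) (a : A) : app₂ (whiskerLeft₂ F σ) a = app₂ σ (F.obj a) := rfl

@[simp] lemma app₂_whiskerRight₂ {F G : LaxBraidedFunctor A B} (σ : F ⟶ G)
    (H : LaxBraidedFunctor B C) (a : A) :
    app₂ (whiskerRight₂ σ H) a = H.map (app₂ σ a) := rfl

end Cells

instance : Bicategory SymMonCat.{u} where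
  Hom A B := LaxBraidedFunctor A B
  homCategory A B := inferInstanceAs (Category (LaxBraidedFunctor A B))
  id A := id₁ A
  comp F G := comp₁ F G
  whiskerLeft {A B C} F _ _ σ := whiskerLeft₂ (A := A) (B := B) (C := C) F σ
  whiskerRight {A B C} _ _ σ G := whiskerRight₂ (A := A) (B := B) (C := C) σ G
  associator {A B C D} F G H :=
    iso₂ (F := comp₁ (comp₁ F G) H) (G := comp₁ F (comp₁ G H)) (fun a => Iso.refl _)
      (fun f => by simp) (by simp [comp_ε]) (fun a a' => by simp [comp_μ])
  leftUnitor {A B} F :=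
    iso₂ (F := comp₁ (id₁ A) F) (G := F) (fun a => Iso.refl _)
      (fun f => by simp) (by simp [comp_ε]) (fun a a' => by simp [comp_μ])
  rightUnitor {A B} F :=
    iso₂ (F := comp₁ F (id₁ B)) (G := F) (fun a => Iso.refl _)
      (fun f => by simp) (by simp [comp_ε]) (fun a a' => by simp [comp_μ])
  whiskerLeft_id _ _ := by apply ext₂; intro a; simp
  whiskerLeft_comp _ _ _ _ _ _ := by apply ext₂; intro a; simp
  id_whiskerLeft _ := by apply ext₂; intro a; simp
  comp_whiskerLeft _ _ _ _ _ := by apply ext₂; intro a; simp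
  id_whiskerRight _ _ := by apply ext₂; intro a; simp
  comp_whiskerRight _ _ _ := by apply ext₂; intro a; simp
  whiskerRight_id _ := by apply ext₂; intro a; simp
  whiskerRight_comp _ _ _ := by apply ext₂; intro a; simp
  whisker_assoc _ _ _ _ _ := by apply ext₂; intro a; simp
  whisker_exchange _ τ := by apply ext₂; intro a; simp [nat₂]
  pentagon _ _ _ _ := by apply ext₂; intro a; simp
  triangle _ _ := by apply ext₂; intro a; simp

lemma ext₁ {A B : Type u} [SmallCategory A] [MonoidalCategory A] [SymmetricCategory A]
    [SmallCategory B] [MonoidalCategory B] [SymmetricCategory B] {F : A ⥤ B} {i j : F.LaxBraided}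
    (hε : i.ε = j.ε) (hμ : ∀ a a', i.μ a a' = j.μ a a') :
    (⟨F, i⟩ : LaxBraidedFunctor A B) = ⟨F, j⟩ := by
  obtain @⟨⟨_, _⟩, _⟩ := i
  obtain @⟨⟨_, _⟩, _⟩ := j
  obtain rfl : _ = _ := hε
  obtain rfl : _ = _ := funext fun a => funext fun a' => hμ a a'
  rfl

lemma app₂_eqToHom {A B : Type u} [SmallCategory A] [MonoidalCategory A] [SymmetricCategory A]
    [SmallCategory B] [MonoidalCategory B] [SymmetricCategory B] {F G : LaxBraidedFunctor A B}
    (h : F = G) (a : A) : app₂ (eqToHom h) a = eqToHom (by rw [h]) := by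
  subst h; rfl

lemma eqToIso₂ {A B : Type u} [SmallCategory A] [MonoidalCategory A] [SymmetricCategory A]
    [SmallCategory B] [MonoidalCategory B] [SymmetricCategory B] {F G : LaxBraidedFunctor A B}
    (e : F ≅ G) (h : F = G) (he : ∀ a, app₂ e.hom a = eqToHom (by rw [h])) : e = eqToIso h := by
  ext a
  rw [he, eqToIso.hom, app₂_eqToHom]

section

variable {A B C D : Type u} [SmallCategory A] [MonoidalCategory A] [SymmetricCategory A]
  [SmallCategory B] [MonoidalCategory B] [SymmetricCategory B]
  [SmallCategory C] [MonoidalCategory C] [SymmetricCategory C]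
  [SmallCategory D] [MonoidalCategory D] [SymmetricCategory D]

lemma id_comp₁ (F : LaxBraidedFunctor A B) : comp₁ (id₁ A) F = F := by
  refine ext₁ (j := F.laxBraided) ?_ (fun a a' => ?_)
  · exact (comp_ε _ _).trans (by simp)
  · exact (comp_μ _ _ _ _).trans (by simp)

lemma comp_id₁ (F : LaxBraidedFunctor A B) : comp₁ F (id₁ B) = F := by
  refine ext₁ (j := F.laxBraided) ?_ (fun a a' => ?_)
  · exact (comp_ε _ _).trans (by simp)
  · exact (comp_μ _ _ _ _).trans (by simp)

lemma comp_assoc₁ (F : LaxBraidedFunctor A B) (G : LaxBraidedFunctor B C)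
    (H : LaxBraidedFunctor C D) : comp₁ (comp₁ F G) H = comp₁ F (comp₁ G H) := by
  refine ext₁ (F := F.toFunctor ⋙ G.toFunctor ⋙ H.toFunctor)
    (i := (comp₁ (comp₁ F G) H).laxBraided) ?_ (fun a a' => ?_)
  · change ε (comp₁ (comp₁ F G) H).toFunctor = ε (comp₁ F (comp₁ G H)).toFunctor
    simp [comp_ε]
  · change μ (comp₁ (comp₁ F G) H).toFunctor a a' = μ (comp₁ F (comp₁ G H)).toFunctor a a'
    simp [comp_μ]

end

/-- Symmetric monoidal categories form a 2-category. -/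
instance : Bicategory.Strict SymMonCat.{u} where
  id_comp {A B} F := id_comp₁ (A := A) (B := B) F
  comp_id {A B} F := comp_id₁ (A := A) (B := B) F
  assoc {A B C D} F G H := comp_assoc₁ (A := A) (B := B) (C := C) (D := D) F G H
  leftUnitor_eqToIso _ := eqToIso₂ _ _ (fun _ => rfl)
  rightUnitor_eqToIso _ := eqToIso₂ _ _ (fun _ => rfl)
  associator_eqToIso _ _ _ := eqToIso₂ _ _ (fun _ => rfl)

section InternalHom

variable {A B C : Type u} [SmallCategory A] [MonoidalCategory A] [SymmetricCategory A]
  [SmallCategory B] [MonoidalCategory B] [SymmetricCategory B]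
  [SmallCategory C] [MonoidalCategory C] [SymmetricCategory C]

lemma assoc_unit {X Y Z : B} (f : 𝟙_ B ⟶ X) (g : 𝟙_ B ⟶ Y) (h : 𝟙_ B ⟶ Z) :
    ((λ_ (𝟙_ B)).inv ≫ ((λ_ (𝟙_ B)).inv ≫ (f ⊗ₘ g) ⊗ₘ h)) ≫ (α_ X Y Z).hom =
      (λ_ (𝟙_ B)).inv ≫ (f ⊗ₘ (λ_ (𝟙_ B)).inv ≫ (g ⊗ₘ h)) := by
  have h1 : ((λ_ (𝟙_ B)).inv ≫ (f ⊗ₘ g) ⊗ₘ h) = ((λ_ (𝟙_ B)).inv ⊗ₘ 𝟙 _) ≫ ((f ⊗ₘ g) ⊗ₘ h) := by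
    rw [tensorHom_comp_tensorHom, Category.id_comp]
  have h2 : (f ⊗ₘ (λ_ (𝟙_ B)).inv ≫ (g ⊗ₘ h)) = (𝟙 _ ⊗ₘ (λ_ (𝟙_ B)).inv) ≫ (f ⊗ₘ (g ⊗ₘ h)) := by
    rw [tensorHom_comp_tensorHom, Category.id_comp]
  rw [h1, h2, Category.assoc, Category.assoc, associator_naturality, ← Category.assoc,
    ← Category.assoc, ← Category.assoc]
  congr 1
  monoidal

lemma assoc_tensor {X₁ X₂ X₃ Y₁ Y₂ Y₃ Z₁ Z₂ Z₃ : B} (f : X₁ ⊗ Y₁ ⟶ Z₁) (g : X₂ ⊗ Y₂ ⟶ Z₂)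
    (h : X₃ ⊗ Y₃ ⟶ Z₃) :
    (tensorμ (X₁ ⊗ X₂) X₃ (Y₁ ⊗ Y₂) Y₃ ≫ (tensorμ X₁ X₂ Y₁ Y₂ ≫ (f ⊗ₘ g) ⊗ₘ h)) ≫
        (α_ Z₁ Z₂ Z₃).hom =
      ((α_ X₁ X₂ X₃).hom ⊗ₘ (α_ Y₁ Y₂ Y₃).hom) ≫ tensorμ X₁ (X₂ ⊗ X₃) Y₁ (Y₂ ⊗ Y₃) ≫
        (f ⊗ₘ tensorμ X₂ X₃ Y₂ Y₃ ≫ (g ⊗ₘ h)) := by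
  have h1 : (tensorμ X₁ X₂ Y₁ Y₂ ≫ (f ⊗ₘ g) ⊗ₘ h) =
      (tensorμ X₁ X₂ Y₁ Y₂ ▷ (X₃ ⊗ Y₃)) ≫ ((f ⊗ₘ g) ⊗ₘ h) := by
    rw [← tensorHom_id, tensorHom_comp_tensorHom, Category.id_comp]
  have h2 : (f ⊗ₘ tensorμ X₂ X₃ Y₂ Y₃ ≫ (g ⊗ₘ h)) =
      ((X₁ ⊗ Y₁) ◁ tensorμ X₂ X₃ Y₂ Y₃) ≫ (f ⊗ₘ (g ⊗ₘ h)) := by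
    rw [← id_tensorHom, tensorHom_comp_tensorHom, Category.id_comp]
  rw [h1, h2, Category.assoc, Category.assoc, associator_naturality, associator_monoidal_assoc]

lemma left_unit {X : B} (f : 𝟙_ B ⟶ X) :
    ((λ_ (𝟙_ B)).inv ≫ (𝟙 (𝟙_ B) ⊗ₘ f)) ≫ (λ_ X).hom = f := by simp

lemma right_unit {X : B} (f : 𝟙_ B ⟶ X) :
    ((λ_ (𝟙_ B)).inv ≫ (f ⊗ₘ 𝟙 (𝟙_ B))) ≫ (ρ_ X).hom = f := by
  simp [unitors_inv_equal]

lemma tensorμ_tensorμ (X₁ X₂ Y₁ Y₂ : B) :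
    tensorμ X₁ X₂ Y₁ Y₂ ≫ tensorμ X₁ Y₁ X₂ Y₂ = 𝟙 _ := by
  have h : (β_ X₂ Y₁).hom ≫ (β_ Y₁ X₂).hom = 𝟙 _ := SymmetricCategory.symmetry _ _
  simp only [tensorμ]
  calc
    _ = 𝟙 _ ⊗≫ X₁ ◁ ((β_ X₂ Y₁).hom ≫ (β_ Y₁ X₂).hom) ▷ Y₂ ⊗≫ 𝟙 _ := by monoidal
    _ = _ := by rw [h]; monoidal

lemma tensorμ_braid (X₁ X₂ Y₁ Y₂ : B) :
    tensorμ X₁ X₂ Y₁ Y₂ ≫ ((β_ X₁ Y₁).hom ⊗ₘ (β_ X₂ Y₂).hom) =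
      (β_ (X₁ ⊗ X₂) (Y₁ ⊗ Y₂)).hom ≫ tensorμ Y₁ Y₂ X₁ X₂ := by
  have h : (β_ X₁ Y₂).hom ≫ (β_ Y₂ X₁).hom = 𝟙 _ := SymmetricCategory.symmetry _ _
  simp only [tensorμ, BraidedCategory.braiding_tensor_left_hom,
    BraidedCategory.braiding_tensor_right_hom, MonoidalCategory.tensorHom_def']
  symm
  calc
    _ = 𝟙 _ ⊗≫ X₁ ◁ (β_ X₂ Y₁).hom ▷ Y₂ ⊗≫ ((β_ X₁ Y₁).hom ▷ (X₂ ⊗ Y₂) ≫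
          (Y₁ ⊗ X₁) ◁ (β_ X₂ Y₂).hom) ⊗≫
        Y₁ ◁ ((β_ X₁ Y₂).hom ≫ (β_ Y₂ X₁).hom) ▷ X₂ ⊗≫ 𝟙 _ := by monoidal
    _ = _ := by rw [h, ← whisker_exchange]; monoidal

lemma left_tensor {X Y Z : B} (f : X ⊗ Y ⟶ Z) :
    (tensorμ (𝟙_ B) X (𝟙_ B) Y ≫ ((λ_ (𝟙_ B)).hom ⊗ₘ f)) ≫ (λ_ Z).hom =
      ((λ_ X).hom ⊗ₘ (λ_ Y).hom) ≫ f := by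
  rw [leftUnitor_monoidal, MonoidalCategory.tensorHom_def]; simp

lemma right_tensor {X Y Z : B} (f : X ⊗ Y ⟶ Z) :
    (tensorμ X (𝟙_ B) Y (𝟙_ B) ≫ (f ⊗ₘ (λ_ (𝟙_ B)).hom)) ≫ (ρ_ Z).hom =
      ((ρ_ X).hom ⊗ₘ (ρ_ Y).hom) ≫ f := by
  rw [rightUnitor_monoidal, MonoidalCategory.tensorHom_def']; simp

lemma braid_unit {X Y : B} (f : 𝟙_ B ⟶ X) (g : 𝟙_ B ⟶ Y) :
    ((λ_ (𝟙_ B)).inv ≫ (f ⊗ₘ g)) ≫ (β_ X Y).hom = (λ_ (𝟙_ B)).inv ≫ (g ⊗ₘ f) := by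
  rw [Category.assoc, BraidedCategory.braiding_naturality]
  simp [unitors_inv_equal]

lemma braid_tensor {X₁ X₂ Y₁ Y₂ Z₁ Z₂ : B} (f : X₁ ⊗ Y₁ ⟶ Z₁) (g : X₂ ⊗ Y₂ ⟶ Z₂) :
    (tensorμ X₁ X₂ Y₁ Y₂ ≫ (f ⊗ₘ g)) ≫ (β_ Z₁ Z₂).hom =
      ((β_ X₁ X₂).hom ⊗ₘ (β_ Y₁ Y₂).hom) ≫ tensorμ X₂ X₁ Y₂ Y₁ ≫ (g ⊗ₘ f) := by
  have h : (β_ (X₁ ⊗ Y₁) (X₂ ⊗ Y₂)).hom =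
      tensorμ X₁ Y₁ X₂ Y₂ ≫ ((β_ X₁ X₂).hom ⊗ₘ (β_ Y₁ Y₂).hom) ≫ tensorμ X₂ X₁ Y₂ Y₁ := by
    rw [← Category.assoc, tensorμ_braid, Category.assoc, tensorμ_tensorμ, Category.comp_id]
  rw [Category.assoc, BraidedCategory.braiding_naturality, h, Category.assoc, Category.assoc,
    ← Category.assoc, tensorμ_tensorμ, Category.id_comp]

lemma tensorμ_braid_assoc (X₁ X₂ Y₁ Y₂ : B) {Z : B} (h : (Y₁ ⊗ X₁) ⊗ (Y₂ ⊗ X₂) ⟶ Z) :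
    tensorμ X₁ X₂ Y₁ Y₂ ≫ ((β_ X₁ Y₁).hom ⊗ₘ (β_ X₂ Y₂).hom) ≫ h =
      (β_ (X₁ ⊗ X₂) (Y₁ ⊗ Y₂)).hom ≫ tensorμ Y₁ Y₂ X₁ X₂ ≫ h := by
  rw [← Category.assoc, tensorμ_braid, Category.assoc]

/-- The underlying functor of the pointwise tensor product `F □ G`. -/
@[simps] abbrev boxFunctor (F G : LaxBraidedFunctor A B) : A ⥤ B where
  obj a := F.obj a ⊗ G.obj a
  map f := F.map f ⊗ₘ G.map f

instance boxLaxBraided (F G : LaxBraidedFunctor A B) : (boxFunctor F G).LaxBraided where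
  ε := (λ_ (𝟙_ B)).inv ≫ (ε F.toFunctor ⊗ₘ ε G.toFunctor)
  μ a a' := tensorμ (F.obj a) (G.obj a) (F.obj a') (G.obj a') ≫
    (μ F.toFunctor a a' ⊗ₘ μ G.toFunctor a a')
  μ_natural_left f X := by
    simp only [tensorμ_natural_left_assoc, Category.assoc, tensorHom_comp_tensorHom, μ_natural_left]
  μ_natural_right X f := by
    simp only [tensorμ_natural_right_assoc, Category.assoc, tensorHom_comp_tensorHom, μ_natural_right]
  associativity X Y Z := by
    have h1 := tensorμ_natural_left (μ F.toFunctor X Y) (μ G.toFunctor X Y) (F.obj Z) (G.obj Z)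
    have h2 := tensorμ_natural_right (F.obj X) (G.obj X) (μ F.toFunctor Y Z) (μ G.toFunctor Y Z)
    simp only [boxFunctor_obj, boxFunctor_map, comp_whiskerRight, Category.assoc,
      MonoidalCategory.whiskerLeft_comp, reassoc_of% h1, reassoc_of% h2, tensorHom_comp_tensorHom,
      associativity]
    simp only [← tensorHom_comp_tensorHom, tensor_associativity_assoc]
  left_unitality X := by
    have h := tensorμ_natural_left (ε F.toFunctor) (ε G.toFunctor) (F.obj X) (G.obj X)
    simp only [boxFunctor_obj, boxFunctor_map, comp_whiskerRight, Category.assoc,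
      reassoc_of% h, tensorHom_comp_tensorHom, tensor_left_unitality]
    simp
  right_unitality X := by
    have h := tensorμ_natural_right (F.obj X) (G.obj X) (ε F.toFunctor) (ε G.toFunctor)
    simp only [boxFunctor_obj, boxFunctor_map, MonoidalCategory.whiskerLeft_comp, Category.assoc,
      reassoc_of% h, tensorHom_comp_tensorHom, tensor_right_unitality]
    simp
  braided X Y := by
    simp only [boxFunctor_obj, boxFunctor_map, Category.assoc, tensorHom_comp_tensorHom,
      Functor.LaxBraided.braided]
    simp only [← tensorHom_comp_tensorHom, tensorμ_braid_assoc]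

/-- The pointwise tensor product `F □ G` of symmetric monoidal functors. -/
abbrev box (F G : LaxBraidedFunctor A B) : LaxBraidedFunctor A B := ⟨boxFunctor F G, inferInstance⟩

/-- The constant functor at the unit. -/
@[simps] abbrev unitFunctor (A B : Type u) [SmallCategory A] [MonoidalCategory A] [SymmetricCategory A]
  [SmallCategory B] [MonoidalCategory B] [SymmetricCategory B] : A ⥤ B where
  obj _ := 𝟙_ B
  map _ := 𝟙 _

instance unitLaxBraided : (unitFunctor A B).LaxBraided where
  ε := 𝟙 _
  μ _ _ := (λ_ (𝟙_ B)).hom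
  associativity _ _ _ := by simp [unitors_equal]; try monoidal
  right_unitality _ := by simp [unitors_equal]
  braided _ _ := by
    change (λ_ (𝟙_ B)).hom ≫ 𝟙 _ = (β_ (𝟙_ B) (𝟙_ B)).hom ≫ (λ_ (𝟙_ B)).hom
    rw [braiding_leftUnitor, unitors_equal, Category.comp_id]

/-- The constant symmetric monoidal functor at the unit. -/
abbrev unit₁ (A B : Type u) [SmallCategory A] [MonoidalCategory A] [SymmetricCategory A]
    [SmallCategory B] [MonoidalCategory B] [SymmetricCategory B] : LaxBraidedFunctor A B :=
  ⟨unitFunctor A B, inferInstance⟩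

@[simp] lemma box_ε (F G : LaxBraidedFunctor A B) : ε (boxFunctor F G) =
    (λ_ (𝟙_ B)).inv ≫ (ε F.toFunctor ⊗ₘ ε G.toFunctor) := rfl

@[simp] lemma box_μ (F G : LaxBraidedFunctor A B) (a a' : A) : μ (boxFunctor F G) a a' =
    tensorμ (F.obj a) (G.obj a) (F.obj a') (G.obj a') ≫
    (μ F.toFunctor a a' ⊗ₘ μ G.toFunctor a a') := rfl

@[simp] lemma unit_ε : ε (unitFunctor A B) = 𝟙 (𝟙_ B) := rfl

@[simp] lemma unit_μ (a a' : A) : μ (unitFunctor A B) a a' = (λ_ (𝟙_ B)).hom := rfl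

/-- The pointwise tensor product of monoidal natural transformations. -/
def box₂ {F G F' G' : LaxBraidedFunctor A B} (σ : F ⟶ G) (τ : F' ⟶ G') : box F F' ⟶ box G G' :=
  mk₂ (fun a => app₂ σ a ⊗ₘ app₂ τ a)
    (fun f => by simp [tensorHom_comp_tensorHom, nat₂])
    (by simp [tensorHom_comp_tensorHom, unit₂])
    (fun a a' => by
      simp only [box_μ, boxFunctor_obj, Category.assoc, tensorHom_comp_tensorHom, tensor₂,
        tensorμ_natural_assoc])

@[simp] lemma app₂_box₂ {F G F' G' : LaxBraidedFunctor A B} (σ : F ⟶ G) (τ : F' ⟶ G') (a : A) :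
    app₂ (box₂ σ τ) a = app₂ σ a ⊗ₘ app₂ τ a := rfl

/-- The associator of `□`. -/
def assoc₂ (F G H : LaxBraidedFunctor A B) : box (box F G) H ≅ box F (box G H) :=
  iso₂ (fun a => α_ (F.obj a) (G.obj a) (H.obj a)) (fun f => associator_naturality _ _ _)
    (assoc_unit _ _ _) (fun _ _ => assoc_tensor _ _ _)

/-- The left unitor of `□`. -/
def left₂ (F : LaxBraidedFunctor A B) : box (unit₁ A B) F ≅ F :=
  iso₂ (fun a => λ_ (F.obj a)) (fun f => by simp) (left_unit _) (fun _ _ => left_tensor _)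

/-- The right unitor of `□`. -/
def right₂ (F : LaxBraidedFunctor A B) : box F (unit₁ A B) ≅ F :=
  iso₂ (fun a => ρ_ (F.obj a)) (fun f => by simp) (right_unit _) (fun _ _ => right_tensor _)

/-- The symmetry of `□`. -/
def braid₂ (F G : LaxBraidedFunctor A B) : box F G ≅ box G F :=
  iso₂ (fun a => β_ (F.obj a) (G.obj a)) (fun f => BraidedCategory.braiding_naturality _ _)
    (braid_unit _ _) (fun _ _ => braid_tensor _ _)

instance : MonoidalCategoryStruct (LaxBraidedFunctor A B) where
  tensorObj F G := box F G
  whiskerLeft F _ _ τ := box₂ (𝟙 F) τ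
  whiskerRight σ G := box₂ σ (𝟙 G)
  tensorHom σ τ := box₂ σ τ
  tensorUnit := unit₁ A B
  associator := assoc₂
  leftUnitor := left₂
  rightUnitor := right₂

section

variable {F G H K : LaxBraidedFunctor A B} (a : A)

@[simp] lemma app₂_tensorHom (σ : F ⟶ G) (τ : H ⟶ K) :
    app₂ (σ ⊗ₘ τ) a = app₂ σ a ⊗ₘ app₂ τ a := rfl

@[simp] lemma app₂_whiskerLeft (F : LaxBraidedFunctor A B) (τ : H ⟶ K) :
    app₂ (F ◁ τ) a = F.obj a ◁ app₂ τ a := id_tensorHom _ _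

@[simp] lemma app₂_whiskerRight (σ : F ⟶ G) (H : LaxBraidedFunctor A B) :
    app₂ (σ ▷ H) a = app₂ σ a ▷ H.obj a := tensorHom_id _ _

@[simp] lemma app₂_associator_hom (F G H : LaxBraidedFunctor A B) :
    app₂ (α_ F G H).hom a = (α_ (F.obj a) (G.obj a) (H.obj a)).hom := rfl

@[simp] lemma app₂_associator_inv (F G H : LaxBraidedFunctor A B) :
    app₂ (α_ F G H).inv a = (α_ (F.obj a) (G.obj a) (H.obj a)).inv := rfl

@[simp] lemma app₂_leftUnitor_hom (F : LaxBraidedFunctor A B) :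
    app₂ (λ_ F).hom a = (λ_ (F.obj a)).hom := rfl

@[simp] lemma app₂_leftUnitor_inv (F : LaxBraidedFunctor A B) :
    app₂ (λ_ F).inv a = (λ_ (F.obj a)).inv := rfl

@[simp] lemma app₂_rightUnitor_hom (F : LaxBraidedFunctor A B) :
    app₂ (ρ_ F).hom a = (ρ_ (F.obj a)).hom := rfl

@[simp] lemma app₂_rightUnitor_inv (F : LaxBraidedFunctor A B) :
    app₂ (ρ_ F).inv a = (ρ_ (F.obj a)).inv := rfl

end

@[simp] lemma tensorObj_obj (F G : LaxBraidedFunctor A B) (a : A) :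
    (F ⊗ G).obj a = F.obj a ⊗ G.obj a := rfl

@[simp] lemma tensorUnit_obj (a : A) : (𝟙_ (LaxBraidedFunctor A B)).obj a = 𝟙_ B := rfl

@[simp] lemma tensorObj_map (F G : LaxBraidedFunctor A B) {a a' : A} (f : a ⟶ a') :
    (F ⊗ G).map f = F.map f ⊗ₘ G.map f := rfl

@[simp] lemma tensorObj_ε (F G : LaxBraidedFunctor A B) :
    ε (F ⊗ G).toFunctor = (λ_ (𝟙_ B)).inv ≫ (ε F.toFunctor ⊗ₘ ε G.toFunctor) := rfl

@[simp] lemma tensorObj_μ (F G : LaxBraidedFunctor A B) (a a' : A) :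
    μ (F ⊗ G).toFunctor a a' = tensorμ (F.obj a) (G.obj a) (F.obj a') (G.obj a') ≫
      (μ F.toFunctor a a' ⊗ₘ μ G.toFunctor a a') := rfl

@[simp] lemma tensorUnit_ε :
    ε (𝟙_ (LaxBraidedFunctor A B)).toFunctor = 𝟙 (𝟙_ B) := rfl

@[simp] lemma tensorUnit_μ (a a' : A) :
    μ (𝟙_ (LaxBraidedFunctor A B)).toFunctor a a' = (λ_ (𝟙_ B)).hom := rfl

@[simp] lemma tensorUnit_map {a a' : A} (f : a ⟶ a') :
    (𝟙_ (LaxBraidedFunctor A B)).map f = 𝟙 (𝟙_ B) := rfl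

instance : MonoidalCategory (LaxBraidedFunctor A B) where
  tensorHom_def _ _ := by ext a; simp [MonoidalCategory.tensorHom_def]
  id_tensorHom_id _ _ := by ext a; exact id_tensorHom_id _ _
  tensorHom_comp_tensorHom _ _ _ _ := by ext a; exact tensorHom_comp_tensorHom _ _ _ _
  whiskerLeft_id _ _ := by ext a; exact id_tensorHom_id _ _
  id_whiskerRight _ _ := by ext a; exact id_tensorHom_id _ _
  associator_naturality _ _ _ := by ext a; exact associator_naturality _ _ _
  leftUnitor_naturality _ := by
    ext a
    simp only [app₂_comp, app₂_whiskerLeft, app₂_leftUnitor_hom]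
    exact leftUnitor_naturality _
  rightUnitor_naturality _ := by
    ext a
    simp only [app₂_comp, app₂_whiskerRight, app₂_rightUnitor_hom]
    exact rightUnitor_naturality _
  pentagon _ _ _ _ := by
    ext a
    simp only [app₂_comp, app₂_whiskerRight, app₂_whiskerLeft, app₂_associator_hom]
    exact pentagon _ _ _ _
  triangle _ _ := by
    ext a
    simp only [app₂_comp, app₂_whiskerRight, app₂_whiskerLeft, app₂_associator_hom,
      app₂_leftUnitor_hom, app₂_rightUnitor_hom]
    exact triangle _ _

instance : BraidedCategory (LaxBraidedFunctor A B) where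
  braiding := braid₂
  braiding_naturality_right F _ _ τ := by
    ext a
    simp only [app₂_comp, app₂_whiskerLeft, app₂_whiskerRight]
    exact BraidedCategory.braiding_naturality_right _ _
  braiding_naturality_left τ F := by
    ext a
    simp only [app₂_comp, app₂_whiskerLeft, app₂_whiskerRight]
    exact BraidedCategory.braiding_naturality_left _ _
  hexagon_forward F G H := by
    ext a
    simp only [app₂_comp, app₂_whiskerLeft, app₂_whiskerRight, app₂_associator_hom]
    exact BraidedCategory.hexagon_forward _ _ _
  hexagon_reverse F G H := by
    ext a
    simp only [app₂_comp, app₂_whiskerLeft, app₂_whiskerRight, app₂_associator_inv]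
    exact BraidedCategory.hexagon_reverse _ _ _

@[simp] lemma app₂_braiding_hom (F G : LaxBraidedFunctor A B) (a : A) :
    app₂ (β_ F G).hom a = (β_ (F.obj a) (G.obj a)).hom := rfl

@[simp] lemma app₂_tensorμ (F G H K : LaxBraidedFunctor A B) (a : A) :
    app₂ (tensorμ F G H K) a = tensorμ (F.obj a) (G.obj a) (H.obj a) (K.obj a) := by
  simp [tensorμ]

instance : SymmetricCategory (LaxBraidedFunctor A B) where
  symmetry F G := by
    ext a
    exact SymmetricCategory.symmetry _ _

end InternalHom

section PostPre

variable {A B C D : Type u} [SmallCategory A] [MonoidalCategory A] [SymmetricCategory A]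
  [SmallCategory B] [MonoidalCategory B] [SymmetricCategory B]
  [SmallCategory C] [MonoidalCategory C] [SymmetricCategory C]
  [SmallCategory D] [MonoidalCategory D] [SymmetricCategory D]

lemma ε_tensor_ε (F : C ⥤ D) [F.LaxMonoidal] :
    (ε F ⊗ₘ ε F) ≫ μ F (𝟙_ C) (𝟙_ C) ≫ F.map (λ_ (𝟙_ C)).hom = (λ_ (𝟙_ D)).hom ≫ ε F := by
  rw [MonoidalCategory.tensorHom_def', Category.assoc, ← left_unitality, leftUnitor_naturality]

lemma ε_tensor_ε' (F : C ⥤ D) [F.LaxMonoidal] :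
    (λ_ (𝟙_ D)).inv ≫ (ε F ⊗ₘ ε F) ≫ μ F (𝟙_ C) (𝟙_ C) = ε F ≫ F.map (λ_ (𝟙_ C)).inv := by
  rw [Iso.inv_comp_eq, ← Category.assoc, ← ε_tensor_ε]
  simp only [Category.assoc, ← Functor.map_comp, Iso.hom_inv_id, CategoryTheory.Functor.map_id,
    Category.comp_id]

lemma ε_tensor_ε_map (F : C ⥤ D) [F.LaxMonoidal] {X Y : C} (f : 𝟙_ C ⟶ X) (g : 𝟙_ C ⟶ Y) :
    (λ_ (𝟙_ D)).inv ≫ (ε F ≫ F.map f ⊗ₘ ε F ≫ F.map g) ≫ μ F X Y =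
      ε F ≫ F.map (λ_ (𝟙_ C)).inv ≫ F.map (f ⊗ₘ g) := by
  rw [← tensorHom_comp_tensorHom, Category.assoc, μ_natural, ← Category.assoc (ε F),
    ← ε_tensor_ε']
  simp only [Category.assoc]

lemma tensorμ_comp_map (F : C ⥤ D) [F.LaxBraided] {W X Y Z U V : C} (f : W ⊗ Y ⟶ U)
    (g : X ⊗ Z ⟶ V) :
    tensorμ (F.obj W) (F.obj X) (F.obj Y) (F.obj Z) ≫
        (μ F W Y ≫ F.map f ⊗ₘ μ F X Z ≫ F.map g) ≫ μ F U V =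
      (μ F W X ⊗ₘ μ F Y Z) ≫ μ F (W ⊗ X) (Y ⊗ Z) ≫ F.map (tensorμ W X Y Z) ≫
        F.map (f ⊗ₘ g) := by
  rw [← tensorHom_comp_tensorHom, Category.assoc, μ_natural,
    tensorμ_comp_μ_tensorHom_μ_comp_μ_assoc]

/-- The underlying functor of `[B, F] : [B, C] ⟶ [B, D]`. -/
abbrev postObjFunctor (B : Type u) [SmallCategory B] [MonoidalCategory B]
    [SymmetricCategory B] (F : LaxBraidedFunctor C D) :
    LaxBraidedFunctor B C ⥤ LaxBraidedFunctor B D where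
  obj G := comp₁ G F
  map σ := whiskerRight₂ σ F

@[simp] lemma postObjFunctor_obj (F : LaxBraidedFunctor C D) (G : LaxBraidedFunctor B C) :
    (postObjFunctor B F).obj G = comp₁ G F := rfl

@[simp] lemma postObjFunctor_map (F : LaxBraidedFunctor C D) {G H : LaxBraidedFunctor B C}
    (σ : G ⟶ H) : (postObjFunctor B F).map σ = whiskerRight₂ σ F := rfl

/-- `[B, F]⁰`. -/
def postObjε (B : Type u) [SmallCategory B] [MonoidalCategory B]
    [SymmetricCategory B] (F : LaxBraidedFunctor C D) : unit₁ B D ⟶ comp₁ (unit₁ B C) F :=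
  mk₂ (fun _ => ε F.toFunctor) (fun _ => by simp) (by simp [comp_ε])
    (fun _ _ => by simp [comp_μ, ε_tensor_ε])

/-- `[B, F]²`. -/
def postObjμ (F : LaxBraidedFunctor C D) (G H : LaxBraidedFunctor B C) :
    box (comp₁ G F) (comp₁ H F) ⟶ comp₁ (box G H) F :=
  mk₂ (fun b => μ F.toFunctor (G.obj b) (H.obj b)) (fun f => by simp)
    (by simp [comp_ε, ε_tensor_ε_map]) (fun b b' => by simp [comp_μ, tensorμ_comp_map])

@[simp] lemma app₂_postObjε (F : LaxBraidedFunctor C D) (b : B) :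
    app₂ (postObjε B F) b = ε F.toFunctor := rfl

@[simp] lemma app₂_postObjμ (F : LaxBraidedFunctor C D) (G H : LaxBraidedFunctor B C) (b : B) :
    app₂ (postObjμ F G H) b = μ F.toFunctor (G.obj b) (H.obj b) := rfl

instance postObjLaxBraided (F : LaxBraidedFunctor C D) : (postObjFunctor B F).LaxBraided where
  ε := postObjε B F
  μ G H := postObjμ F G H
  μ_natural_left _ _ := by ext b; simp
  μ_natural_right _ _ := by ext b; simp
  associativity _ _ _ := by ext b; simp
  left_unitality _ := by ext b; simp
  right_unitality _ := by ext b; simp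
  braided _ _ := by ext b; simp [Functor.LaxBraided.braided]

/-- `[B, F] : [B, C] ⟶ [B, D]`, post-composition with `F`. -/
abbrev postObj (B : Type u) [SmallCategory B] [MonoidalCategory B]
    [SymmetricCategory B] (F : LaxBraidedFunctor C D) :
    LaxBraidedFunctor (LaxBraidedFunctor B C) (LaxBraidedFunctor B D) :=
  ⟨postObjFunctor B F, inferInstance⟩

@[simp] lemma postObj_ε (F : LaxBraidedFunctor C D) : 
    ε (postObjFunctor B F) = postObjε B F := rfl

@[simp] lemma postObj_μ (F : LaxBraidedFunctor C D) (G H : LaxBraidedFunctor B C) : 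
    μ (postObjFunctor B F) G H = postObjμ F G H := rfl

/-- `[B, σ] : [B, F] ⟶ [B, G]`. -/
def postMap (B : Type u) [SmallCategory B] [MonoidalCategory B]
    [SymmetricCategory B] {F G : LaxBraidedFunctor C D} (σ : F ⟶ G) :
    postObj B F ⟶ postObj B G :=
  mk₂ (fun H => whiskerLeft₂ H σ) (fun τ => by ext b; simp [nat₂])
    (by ext b; simp [unit₂]) (fun H K => by ext b; simp [tensor₂])

@[simp] lemma app₂_postMap {F G : LaxBraidedFunctor C D} (σ : F ⟶ G) (H : LaxBraidedFunctor B C) :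
    app₂ (postMap B σ) H = whiskerLeft₂ H σ := rfl

/-- The underlying functor of `[B, -] : [C, D] ⟶ [[B, C], [B, D]]`. -/
abbrev postFunctor (B C D : Type u) [SmallCategory B] [MonoidalCategory B]
    [SymmetricCategory B] [SmallCategory C] [MonoidalCategory C]
    [SymmetricCategory C] [SmallCategory D] [MonoidalCategory D] [SymmetricCategory D] :
    LaxBraidedFunctor C D ⥤
      LaxBraidedFunctor (LaxBraidedFunctor B C) (LaxBraidedFunctor B D) where
  obj F := postObj B F
  map σ := postMap B σ

@[simp] lemma postFunctor_obj (F : LaxBraidedFunctor C D) :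
    (postFunctor B C D).obj F = postObj B F := rfl

@[simp] lemma postFunctor_map {F G : LaxBraidedFunctor C D} (σ : F ⟶ G) :
    (postFunctor B C D).map σ = postMap B σ := rfl

/-- The identity `I ⟶ [B, I]`. -/
def postε (B C D : Type u) [SmallCategory B] [MonoidalCategory B]
    [SymmetricCategory B] [SmallCategory C] [MonoidalCategory C]
    [SymmetricCategory C] [SmallCategory D] [MonoidalCategory D] [SymmetricCategory D] :
    unit₁ (LaxBraidedFunctor B C) (LaxBraidedFunctor B D) ⟶ postObj B (unit₁ C D) :=
  mk₂ (fun H => mk₂ (fun b => 𝟙 (𝟙_ D)) (fun _ => by simp) (by simp [comp_ε])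
    (fun _ _ => by simp [comp_μ]))
    (fun _ => by ext; simp) (by ext; simp) (fun _ _ => by ext; simp)

/-- The identity `[B, F] □ [B, G] ⟶ [B, F □ G]`. -/
def postμ (F G : LaxBraidedFunctor C D) :
    box (postObj B F) (postObj B G) ⟶ postObj B (box F G) :=
  mk₂ (fun H => mk₂ (fun b => 𝟙 (F.obj (H.obj b) ⊗ G.obj (H.obj b))) (fun _ => by simp)
      (by simp [comp_ε]) (fun _ _ => by simp [comp_μ]))
    (fun _ => by ext; simp) (by ext; simp) (fun _ _ => by ext; simp)

@[simp] lemma app₂_postε (H : LaxBraidedFunctor B C) (b : B) :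
    app₂ (app₂ (postε B C D) H) b = 𝟙 _ := rfl

@[simp] lemma app₂_postμ (F G : LaxBraidedFunctor C D) (H : LaxBraidedFunctor B C) (b : B) :
    app₂ (app₂ (postμ F G) H) b = 𝟙 _ := rfl

instance postLaxBraided : (postFunctor B C D).LaxBraided where
  ε := postε B C D
  μ F G := postμ F G
  μ_natural_left _ _ := by ext; simp
  μ_natural_right _ _ := by ext; simp
  associativity _ _ _ := by ext; simp
  left_unitality _ := by ext; simp
  right_unitality _ := by ext; simp
  braided _ _ := by ext; simp

/-- `[B, -] : [C, D] ⟶ [[B, C], [B, D]]`. -/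
abbrev post (B C D : Type u) [SmallCategory B] [MonoidalCategory B]
    [SymmetricCategory B] [SmallCategory C] [MonoidalCategory C]
    [SymmetricCategory C] [SmallCategory D] [MonoidalCategory D] [SymmetricCategory D] :
    LaxBraidedFunctor (LaxBraidedFunctor C D)
      (LaxBraidedFunctor (LaxBraidedFunctor B C) (LaxBraidedFunctor B D)) :=
  ⟨postFunctor B C D, inferInstance⟩

/-- The underlying functor of `[F, C] : [B, C] ⟶ [A, C]`. -/
abbrev preFunctor (F : LaxBraidedFunctor A B) (C : Type u) [SmallCategory C]
    [MonoidalCategory C] [SymmetricCategory C] :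
    LaxBraidedFunctor B C ⥤ LaxBraidedFunctor A C where
  obj G := comp₁ F G
  map σ := whiskerLeft₂ F σ

@[simp] lemma preFunctor_obj (F : LaxBraidedFunctor A B) (G : LaxBraidedFunctor B C) :
    (preFunctor F C).obj G = comp₁ F G := rfl

@[simp] lemma preFunctor_map (F : LaxBraidedFunctor A B) {G H : LaxBraidedFunctor B C}
    (σ : G ⟶ H) : (preFunctor F C).map σ = whiskerLeft₂ F σ := rfl

/-- The identity `I ⟶ [F, C](I)`. -/
def preε (F : LaxBraidedFunctor A B) (C : Type u) [SmallCategory C]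
    [MonoidalCategory C] [SymmetricCategory C] : unit₁ A C ⟶ comp₁ F (unit₁ B C) :=
  mk₂ (fun _ => 𝟙 (𝟙_ C)) (fun _ => by simp) (by simp [comp_ε])
    (fun _ _ => by simp [comp_μ])

/-- The identity `[F, C](G) □ [F, C](H) ⟶ [F, C](G □ H)`. -/
def preμ (F : LaxBraidedFunctor A B) (G H : LaxBraidedFunctor B C) :
    box (comp₁ F G) (comp₁ F H) ⟶ comp₁ F (box G H) :=
  mk₂ (fun a => 𝟙 (G.obj (F.obj a) ⊗ H.obj (F.obj a))) (fun _ => by simp)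
    (by simp [comp_ε]) (fun _ _ => by simp [comp_μ])

@[simp] lemma app₂_preε (F : LaxBraidedFunctor A B) (a : A) : app₂ (preε F C) a = 𝟙 _ := rfl

@[simp] lemma app₂_preμ (F : LaxBraidedFunctor A B) (G H : LaxBraidedFunctor B C) (a : A) :
    app₂ (preμ F G H) a = 𝟙 _ := rfl

instance preLaxBraided (F : LaxBraidedFunctor A B) : (preFunctor F C).LaxBraided where
  ε := preε F C
  μ G H := preμ F G H
  μ_natural_left _ _ := by ext; simp
  μ_natural_right _ _ := by ext; simp
  associativity _ _ _ := by ext; simp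
  left_unitality _ := by ext; simp
  right_unitality _ := by ext; simp
  braided _ _ := by ext; simp

/-- `[F, C] : [B, C] ⟶ [A, C]`, pre-composition with `F`. -/
abbrev pre (F : LaxBraidedFunctor A B) (C : Type u) [SmallCategory C]
    [MonoidalCategory C] [SymmetricCategory C] :
    LaxBraidedFunctor (LaxBraidedFunctor B C) (LaxBraidedFunctor A C) :=
  ⟨preFunctor F C, inferInstance⟩

end PostPre

section Tensor

/-- The objects of `A ⊗ B`: formal words on symbols `a ⊗ b`, with a formal unit and a formal
binary tensor. -/
inductive TObj (A B : Type u) : Type u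
  | unit : TObj A B
  | pure (a : A) (b : B) : TObj A B
  | tensor (X Y : TObj A B) : TObj A B

variable (A B : Type u) [SmallCategory A] [MonoidalCategory A] [SymmetricCategory A]
  [SmallCategory B] [MonoidalCategory B] [SymmetricCategory B]

/-- The formal arrows of `A ⊗ B`, generated under composition and under tensoring with objects
by the canonical arrows, by `a ⊗ g` and `f ⊗ b`, and by
`α_b : I ⟶ I ⊗ b`, `β_a : I ⟶ a ⊗ I`,
`γ_{a,a',b} : (a ⊗ b) ⊗ (a' ⊗ b) ⟶ (a ⊗ a') ⊗ b` and
`δ_{a,b,b'} : (a ⊗ b) ⊗ (a ⊗ b') ⟶ a ⊗ (b ⊗ b')`. -/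
inductive THom : TObj A B → TObj A B → Type u
  | id (X : TObj A B) : THom X X
  | comp {X Y Z : TObj A B} (p : THom X Y) (q : THom Y Z) : THom X Z
  | whiskerLeft (X : TObj A B) {Y Z : TObj A B} (p : THom Y Z) : THom (X.tensor Y) (X.tensor Z)
  | whiskerRight {Y Z : TObj A B} (p : THom Y Z) (X : TObj A B) : THom (Y.tensor X) (Z.tensor X)
  | assoc (X Y Z : TObj A B) : THom ((X.tensor Y).tensor Z) (X.tensor (Y.tensor Z))
  | assocInv (X Y Z : TObj A B) : THom (X.tensor (Y.tensor Z)) ((X.tensor Y).tensor Z)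
  | left (X : TObj A B) : THom (TObj.unit.tensor X) X
  | leftInv (X : TObj A B) : THom X (TObj.unit.tensor X)
  | right (X : TObj A B) : THom (X.tensor TObj.unit) X
  | rightInv (X : TObj A B) : THom X (X.tensor TObj.unit)
  | symm (X Y : TObj A B) : THom (X.tensor Y) (Y.tensor X)
  | mapRight (a : A) {b b' : B} (g : b ⟶ b') : THom (.pure a b) (.pure a b')
  | mapLeft {a a' : A} (f : a ⟶ a') (b : B) : THom (.pure a b) (.pure a' b)
  | alpha (b : B) : THom .unit (.pure (𝟙_ A) b)
  | beta (a : A) : THom .unit (.pure a (𝟙_ B))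
  | gamma (a a' : A) (b : B) :
      THom ((TObj.pure a b).tensor (.pure a' b)) (.pure (a ⊗ a') b)
  | delta (a : A) (b b' : B) :
      THom ((TObj.pure a b).tensor (.pure a b')) (.pure a (b ⊗ b'))

variable {A B}

local infixr:75 " ⊙ " => THom.comp
local infixr:81 " ◃ " => THom.whiskerLeft
local infixl:81 " ▹ " => THom.whiskerRight

/-- The formal tensor product of arrows. -/
def THom.tensorHom {X Y Z W : TObj A B} (p : THom A B X Y) (q : THom A B Z W) :
    THom A B (X.tensor Z) (Y.tensor W) := p ▹ Z ⊙ Y ◃ q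

/-- The formal middle interchange `(X ⊗ Y) ⊗ (Z ⊗ W) ⟶ (X ⊗ Z) ⊗ (Y ⊗ W)`. -/
def THom.interchange (X Y Z W : TObj A B) :
    THom A B ((X.tensor Y).tensor (Z.tensor W)) ((X.tensor Z).tensor (Y.tensor W)) :=
  .assoc X Y (Z.tensor W) ⊙ X ◃ .assocInv Y Z W ⊙ X ◃ (.symm Y Z ▹ W) ⊙
    X ◃ .assoc Z Y W ⊙ .assocInv X Z (Y.tensor W)

open THom in
/-- The relations between the formal arrows of `A ⊗ B`. -/
inductive TRel : {X Y : TObj A B} → THom A B X Y → THom A B X Y → Prop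
  -- congruence
  | refl {X Y : TObj A B} (p : THom A B X Y) : TRel p p
  | symm {X Y : TObj A B} {p q : THom A B X Y} : TRel p q → TRel q p
  | trans {X Y : TObj A B} {p q r : THom A B X Y} : TRel p q → TRel q r → TRel p r
  | comp {X Y Z : TObj A B} {p p' : THom A B X Y} {q q' : THom A B Y Z} :
      TRel p p' → TRel q q' → TRel (p ⊙ q) (p' ⊙ q')
  | whiskerLeft (X : TObj A B) {Y Z : TObj A B} {p p' : THom A B Y Z} :
      TRel p p' → TRel (X ◃ p) (X ◃ p')
  | whiskerRight {Y Z : TObj A B} {p p' : THom A B Y Z} (X : TObj A B) :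
      TRel p p' → TRel (p ▹ X) (p' ▹ X)
  -- category
  | id_comp {X Y : TObj A B} (p : THom A B X Y) : TRel (id X ⊙ p) p
  | comp_id {X Y : TObj A B} (p : THom A B X Y) : TRel (p ⊙ id Y) p
  | comp_assoc {X Y Z W : TObj A B} (p : THom A B X Y) (q : THom A B Y Z) (r : THom A B Z W) :
      TRel ((p ⊙ q) ⊙ r) (p ⊙ q ⊙ r)
  -- the tensor is a bifunctor
  | whiskerLeft_id (X Y : TObj A B) : TRel (X ◃ id Y) (id (X.tensor Y))
  | whiskerLeft_comp (W : TObj A B) {X Y Z : TObj A B} (p : THom A B X Y) (q : THom A B Y Z) :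
      TRel (W ◃ (p ⊙ q)) (W ◃ p ⊙ W ◃ q)
  | id_whiskerRight (X Y : TObj A B) : TRel (id X ▹ Y) (id (X.tensor Y))
  | comp_whiskerRight {X Y Z : TObj A B} (p : THom A B X Y) (q : THom A B Y Z) (W : TObj A B) :
      TRel ((p ⊙ q) ▹ W) (p ▹ W ⊙ q ▹ W)
  | exchange {X Y Z W : TObj A B} (p : THom A B X Y) (q : THom A B Z W) :
      TRel (X ◃ q ⊙ p ▹ W) (p ▹ Z ⊙ Y ◃ q)
  -- the canonical arrows are invertible
  | assoc_inv (X Y Z : TObj A B) :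
      TRel (assoc X Y Z ⊙ assocInv X Y Z) (id ((X.tensor Y).tensor Z))
  | inv_assoc (X Y Z : TObj A B) :
      TRel (assocInv X Y Z ⊙ assoc X Y Z) (id (X.tensor (Y.tensor Z)))
  | left_inv (X : TObj A B) : TRel (left X ⊙ leftInv X) (id (TObj.unit.tensor X))
  | inv_left (X : TObj A B) : TRel (leftInv X ⊙ left X) (id X)
  | right_inv (X : TObj A B) : TRel (right X ⊙ rightInv X) (id (X.tensor TObj.unit))
  | inv_right (X : TObj A B) : TRel (rightInv X ⊙ right X) (id X)
  | symm_symm (X Y : TObj A B) : TRel (THom.symm X Y ⊙ THom.symm Y X) (id (X.tensor Y))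
  -- the canonical arrows are natural
  | assoc_nat_left {X X' : TObj A B} (p : THom A B X X') (Y Z : TObj A B) :
      TRel (p ▹ Y ▹ Z ⊙ assoc X' Y Z) (assoc X Y Z ⊙ p ▹ (Y.tensor Z))
  | assoc_nat_middle (X : TObj A B) {Y Y' : TObj A B} (p : THom A B Y Y') (Z : TObj A B) :
      TRel ((X ◃ p) ▹ Z ⊙ assoc X Y' Z) (assoc X Y Z ⊙ X ◃ (p ▹ Z))
  | assoc_nat_right (X Y : TObj A B) {Z Z' : TObj A B} (p : THom A B Z Z') :
      TRel ((X.tensor Y) ◃ p ⊙ assoc X Y Z') (assoc X Y Z ⊙ X ◃ Y ◃ p)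
  | left_nat {X X' : TObj A B} (p : THom A B X X') :
      TRel (TObj.unit ◃ p ⊙ left X') (left X ⊙ p)
  | right_nat {X X' : TObj A B} (p : THom A B X X') :
      TRel (p ▹ TObj.unit ⊙ right X') (right X ⊙ p)
  | symm_nat_left {X X' : TObj A B} (p : THom A B X X') (Y : TObj A B) :
      TRel (p ▹ Y ⊙ THom.symm X' Y) (THom.symm X Y ⊙ Y ◃ p)
  | symm_nat_right (X : TObj A B) {Y Y' : TObj A B} (p : THom A B Y Y') :
      TRel (X ◃ p ⊙ THom.symm X Y') (THom.symm X Y ⊙ p ▹ X)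
  -- coherence
  | pentagon (X Y Z W : TObj A B) :
      TRel (assoc X Y Z ▹ W ⊙ assoc X (Y.tensor Z) W ⊙ X ◃ assoc Y Z W)
        (assoc (X.tensor Y) Z W ⊙ assoc X Y (Z.tensor W))
  | triangle (X Y : TObj A B) :
      TRel (assoc X TObj.unit Y ⊙ X ◃ left Y) (right X ▹ Y)
  | symm_left (X : TObj A B) : TRel (THom.symm X TObj.unit ⊙ left X) (right X)
  | hexagon (X Y Z : TObj A B) :
      TRel (assoc X Y Z ⊙ THom.symm X (Y.tensor Z) ⊙ assoc Y Z X)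
        (THom.symm X Y ▹ Z ⊙ assoc Y X Z ⊙ Y ◃ THom.symm X Z)
  -- `(a, b) ↦ a ⊗ b` is a functor of two variables
  | mapRight_id (a : A) (b : B) : TRel (mapRight a (𝟙 b)) (id (.pure a b))
  | mapRight_comp (a : A) {b b' b'' : B} (g : b ⟶ b') (g' : b' ⟶ b'') :
      TRel (mapRight a (g ≫ g')) (mapRight a g ⊙ mapRight a g')
  | mapLeft_id (a : A) (b : B) : TRel (mapLeft (𝟙 a) b) (id (.pure a b))
  | mapLeft_comp {a a' a'' : A} (f : a ⟶ a') (f' : a' ⟶ a'') (b : B) :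
      TRel (mapLeft (f ≫ f') b) (mapLeft f b ⊙ mapLeft f' b)
  | mapLeft_mapRight {a a' : A} (f : a ⟶ a') {b b' : B} (g : b ⟶ b') :
      TRel (mapLeft f b ⊙ mapRight a' g) (mapRight a g ⊙ mapLeft f b')
  -- `α`, `β`, `γ` and `δ` are natural
  | alpha_nat {b b' : B} (g : b ⟶ b') : TRel (alpha b ⊙ mapRight (𝟙_ A) g) (alpha b')
  | beta_nat {a a' : A} (f : a ⟶ a') : TRel (beta a ⊙ mapLeft f (𝟙_ B)) (beta a')
  | gamma_nat_left {a₁ a₂ : A} (f : a₁ ⟶ a₂) (a' : A) (b : B) :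
      TRel (mapLeft f b ▹ (.pure a' b) ⊙ gamma a₂ a' b) (gamma a₁ a' b ⊙ mapLeft (f ▷ a') b)
  | gamma_nat_right (a : A) {a₁ a₂ : A} (f : a₁ ⟶ a₂) (b : B) :
      TRel ((.pure a b) ◃ mapLeft f b ⊙ gamma a a₂ b) (gamma a a₁ b ⊙ mapLeft (a ◁ f) b)
  | gamma_nat (a a' : A) {b b' : B} (g : b ⟶ b') :
      TRel ((mapRight a g).tensorHom (mapRight a' g) ⊙ gamma a a' b')
        (gamma a a' b ⊙ mapRight (a ⊗ a') g)
  | delta_nat_left (a : A) {b₁ b₂ : B} (g : b₁ ⟶ b₂) (b' : B) :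
      TRel (mapRight a g ▹ (.pure a b') ⊙ delta a b₂ b') (delta a b₁ b' ⊙ mapRight a (g ▷ b'))
  | delta_nat_right (a : A) (b : B) {b₁ b₂ : B} (g : b₁ ⟶ b₂) :
      TRel ((.pure a b) ◃ mapRight a g ⊙ delta a b b₂) (delta a b b₁ ⊙ mapRight a (b ◁ g))
  | delta_nat {a a' : A} (f : a ⟶ a') (b b' : B) :
      TRel ((mapLeft f b).tensorHom (mapLeft f b') ⊙ delta a' b b')
        (delta a b b' ⊙ mapLeft f (b ⊗ b'))
  -- `a ⊗ -` with `β_a` and `δ_{a,-,-}` is a symmetric monoidal functor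
  | delta_assoc (a : A) (b b' b'' : B) :
      TRel (delta a b b' ▹ (.pure a b'') ⊙ delta a (b ⊗ b') b'' ⊙ mapRight a (α_ b b' b'').hom)
        (assoc _ _ _ ⊙ (.pure a b) ◃ delta a b' b'' ⊙ delta a b (b' ⊗ b''))
  | delta_left (a : A) (b : B) :
      TRel (left (.pure a b)) (beta a ▹ (.pure a b) ⊙ delta a (𝟙_ B) b ⊙ mapRight a (λ_ b).hom)
  | delta_right (a : A) (b : B) :
      TRel (right (.pure a b)) ((.pure a b) ◃ beta a ⊙ delta a b (𝟙_ B) ⊙ mapRight a (ρ_ b).hom)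
  | delta_symm (a : A) (b b' : B) :
      TRel (delta a b b' ⊙ mapRight a (β_ b b').hom) (THom.symm _ _ ⊙ delta a b' b)
  -- `- ⊗ b` with `α_b` and `γ_{-,-,b}` is a symmetric monoidal functor
  | gamma_assoc (a a' a'' : A) (b : B) :
      TRel (gamma a a' b ▹ (.pure a'' b) ⊙ gamma (a ⊗ a') a'' b ⊙ mapLeft (α_ a a' a'').hom b)
        (assoc _ _ _ ⊙ (.pure a b) ◃ gamma a' a'' b ⊙ gamma a (a' ⊗ a'') b)
  | gamma_left (a : A) (b : B) :
      TRel (left (.pure a b)) (alpha b ▹ (.pure a b) ⊙ gamma (𝟙_ A) a b ⊙ mapLeft (λ_ a).hom b)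
  | gamma_right (a : A) (b : B) :
      TRel (right (.pure a b)) ((.pure a b) ◃ alpha b ⊙ gamma a (𝟙_ A) b ⊙ mapLeft (ρ_ a).hom b)
  | gamma_symm (a a' : A) (b : B) :
      TRel (gamma a a' b ⊙ mapLeft (β_ a a').hom b) (THom.symm _ _ ⊙ gamma a' a b)
  -- `α` is monoidal in `b`, `β` is monoidal in `a`, and `γ` and `δ` are compatible
  | alpha_delta (b b' : B) :
      TRel (left .unit ⊙ alpha (b ⊗ b'))
        ((alpha b).tensorHom (alpha b') ⊙ delta (𝟙_ A) b b')
  | beta_gamma (a a' : A) :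
      TRel (left .unit ⊙ beta (a ⊗ a'))
        ((beta a).tensorHom (beta a') ⊙ gamma a a' (𝟙_ B))
  | beta_alpha : TRel (beta (𝟙_ A)) (alpha (𝟙_ B))
  | delta_gamma (a a' : A) (b b' : B) :
      TRel ((delta a b b').tensorHom (delta a' b b') ⊙ gamma a a' (b ⊗ b'))
        (interchange _ _ _ _ ⊙ (gamma a a' b).tensorHom (gamma a a' b') ⊙ delta (a ⊗ a') b b')

variable (A B)

/-- The relation `TRel` as a setoid. -/
def tSetoid (X Y : TObj A B) : Setoid (THom A B X Y) :=
  ⟨TRel, .refl, .symm, .trans⟩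

variable {A B}

instance : CategoryStruct (TObj A B) where
  Hom X Y := _root_.Quotient (tSetoid A B X Y)
  id X := Quotient.mk _ (THom.id X)
  comp := Quotient.map₂ THom.comp (fun _ _ h _ _ h' => TRel.comp h h')

/-- The arrow of `A ⊗ B` represented by a formal arrow. -/
def THom.cls {X Y : TObj A B} (p : THom A B X Y) : X ⟶ Y := Quotient.mk (tSetoid A B X Y) p

lemma THom.cls_surj {X Y : TObj A B} (f : X ⟶ Y) : ∃ p : THom A B X Y, p.cls = f :=
  Quotient.exists_rep f

lemma TRel.cls {X Y : TObj A B} {p q : THom A B X Y} (h : TRel p q) : p.cls = q.cls :=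
  Quotient.sound h

lemma THom.id_cls (X : TObj A B) : (THom.id X).cls = 𝟙 X := rfl

lemma THom.comp_cls {X Y Z : TObj A B} (p : THom A B X Y) (q : THom A B Y Z) :
    (p ⊙ q).cls = p.cls ≫ q.cls := rfl

instance : SmallCategory (TObj A B) where
  id_comp f := by obtain ⟨p, rfl⟩ := THom.cls_surj f; exact (TRel.id_comp p).cls
  comp_id f := by obtain ⟨p, rfl⟩ := THom.cls_surj f; exact (TRel.comp_id p).cls
  assoc f g h := by
    obtain ⟨p, rfl⟩ := THom.cls_surj f
    obtain ⟨q, rfl⟩ := THom.cls_surj g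
    obtain ⟨r, rfl⟩ := THom.cls_surj h
    exact (TRel.comp_assoc p q r).cls

/-- Tensoring an arrow with an object on the left. -/
def tWhiskerLeft (X : TObj A B) {Y Z : TObj A B} : (Y ⟶ Z) → (X.tensor Y ⟶ X.tensor Z) :=
  Quotient.map (THom.whiskerLeft X) (fun _ _ h => TRel.whiskerLeft X h)

/-- Tensoring an arrow with an object on the right. -/
def tWhiskerRight {Y Z : TObj A B} (f : Y ⟶ Z) (X : TObj A B) : Y.tensor X ⟶ Z.tensor X :=
  Quotient.map (fun p => THom.whiskerRight p X) (fun _ _ h => TRel.whiskerRight X h) f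

instance : MonoidalCategoryStruct (TObj A B) where
  tensorObj := TObj.tensor
  tensorUnit := TObj.unit
  whiskerLeft X _ _ f := tWhiskerLeft X f
  whiskerRight f X := tWhiskerRight f X
  tensorHom {_ Y Z _} f g := tWhiskerRight f Z ≫ tWhiskerLeft Y g
  associator X Y Z := ⟨(THom.assoc X Y Z).cls, (THom.assocInv X Y Z).cls,
    (TRel.assoc_inv X Y Z).cls, (TRel.inv_assoc X Y Z).cls⟩
  leftUnitor X := ⟨(THom.left X).cls, (THom.leftInv X).cls,
    (TRel.left_inv X).cls, (TRel.inv_left X).cls⟩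
  rightUnitor X := ⟨(THom.right X).cls, (THom.rightInv X).cls,
    (TRel.right_inv X).cls, (TRel.inv_right X).cls⟩

instance : MonoidalCategory (TObj A B) where
  tensorHom_def _ _ := rfl
  id_tensorHom_id X Y :=
    ((TRel.comp (.id_whiskerRight X Y) (.whiskerLeft_id X Y)).trans (.id_comp _)).cls
  tensorHom_comp_tensorHom f₁ f₂ g₁ g₂ := by
    obtain ⟨p₁, rfl⟩ := THom.cls_surj f₁
    obtain ⟨p₂, rfl⟩ := THom.cls_surj f₂
    obtain ⟨q₁, rfl⟩ := THom.cls_surj g₁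
    obtain ⟨q₂, rfl⟩ := THom.cls_surj g₂
    change (p₁ ▹ _ ⊙ _ ◃ p₂).cls ≫ (q₁ ▹ _ ⊙ _ ◃ q₂).cls =
      ((p₁ ⊙ q₁) ▹ _ ⊙ _ ◃ (p₂ ⊙ q₂)).cls
    simp only [THom.comp_cls, (TRel.comp_whiskerRight _ _ _).cls,
      (TRel.whiskerLeft_comp _ _ _).cls, Category.assoc]
    have h := (TRel.exchange q₁ p₂).cls
    simp only [THom.comp_cls] at h
    rw [reassoc_of% h]
  whiskerLeft_id X Y := (TRel.whiskerLeft_id X Y).cls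
  id_whiskerRight X Y := (TRel.id_whiskerRight X Y).cls
  associator_naturality {X₁ X₂ X₃ Y₁ Y₂ Y₃} f₁ f₂ f₃ := by
    obtain ⟨p₁, rfl⟩ := THom.cls_surj f₁
    obtain ⟨p₂, rfl⟩ := THom.cls_surj f₂
    obtain ⟨p₃, rfl⟩ := THom.cls_surj f₃
    change (((p₁ ▹ X₂ ⊙ Y₁ ◃ p₂) ▹ X₃ ⊙ (Y₁.tensor Y₂) ◃ p₃) ⊙ .assoc _ _ _).cls =
      (.assoc _ _ _ ⊙ p₁ ▹ (X₂.tensor X₃) ⊙ Y₁ ◃ (p₂ ▹ X₃ ⊙ Y₂ ◃ p₃)).cls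
    have h₁ := (TRel.assoc_nat_left p₁ X₂ X₃).cls
    have h₂ := (TRel.assoc_nat_middle Y₁ p₂ X₃).cls
    have h₃ := (TRel.assoc_nat_right Y₁ Y₂ p₃).cls
    simp only [THom.comp_cls, (TRel.comp_whiskerRight _ _ _).cls,
      (TRel.whiskerLeft_comp _ _ _).cls, Category.assoc] at h₁ h₂ h₃ ⊢
    rw [h₃, reassoc_of% h₂, reassoc_of% h₁]
  leftUnitor_naturality f := by
    obtain ⟨p, rfl⟩ := THom.cls_surj f
    exact (TRel.left_nat p).cls
  rightUnitor_naturality f := by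
    obtain ⟨p, rfl⟩ := THom.cls_surj f
    exact (TRel.right_nat p).cls
  pentagon X Y Z W := (TRel.pentagon X Y Z W).cls
  triangle X Y := (TRel.triangle X Y).cls

/-- The symmetry of `A ⊗ B`. -/
def tSymm (X Y : TObj A B) : X ⊗ Y ≅ Y ⊗ X :=
  ⟨(THom.symm X Y).cls, (THom.symm Y X).cls, (TRel.symm_symm X Y).cls, (TRel.symm_symm Y X).cls⟩

lemma tHexagon (X Y Z : TObj A B) : (α_ X Y Z).hom ≫ (tSymm X (Y ⊗ Z)).hom ≫ (α_ Y Z X).hom =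
    (tSymm X Y).hom ▷ Z ≫ (α_ Y X Z).hom ≫ Y ◁ (tSymm X Z).hom :=
  (TRel.hexagon X Y Z).cls

lemma tSymm_inv (X Y : TObj A B) : (tSymm X Y).inv = (tSymm Y X).hom := rfl

instance : BraidedCategory (TObj A B) where
  braiding := tSymm
  braiding_naturality_right X _ _ f := by
    obtain ⟨p, rfl⟩ := THom.cls_surj f
    exact (TRel.symm_nat_right X p).cls
  braiding_naturality_left f Y := by
    obtain ⟨p, rfl⟩ := THom.cls_surj f
    exact (TRel.symm_nat_left p Y).cls
  hexagon_forward := tHexagon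
  hexagon_reverse X Y Z := by
    have h : α_ Z X Y ≪≫ tSymm Z (X ⊗ Y) ≪≫ α_ X Y Z =
        whiskerRightIso (tSymm Z X) Y ≪≫ α_ X Z Y ≪≫ whiskerLeftIso X (tSymm Z Y) :=
      Iso.ext (tHexagon Z X Y)
    have h' := congrArg Iso.inv h
    simp only [Iso.trans_inv, whiskerRightIso_inv, whiskerLeftIso_inv, tSymm_inv,
      Category.assoc] at h'
    exact h'

instance : SymmetricCategory (TObj A B) where
  symmetry X Y := (TRel.symm_symm X Y).cls

end Tensor

section Eta

variable (A B : Type u) [SmallCategory A] [MonoidalCategory A] [SymmetricCategory A]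
  [SmallCategory B] [MonoidalCategory B] [SymmetricCategory B]

variable {A B}

/-- The functor `a ⊗ - : B ⥤ A ⊗ B`. -/
abbrev etaObjFunctor (B : Type u) [SmallCategory B] [MonoidalCategory B] [SymmetricCategory B]
    (a : A) : B ⥤ TObj A B where
  obj b := .pure a b
  map g := (THom.mapRight a g).cls
  map_id b := (TRel.mapRight_id a b).cls
  map_comp g g' := (TRel.mapRight_comp a g g').cls

instance etaObjLaxBraided (a : A) : (etaObjFunctor B a).LaxBraided where
  ε := (THom.beta a).cls
  μ b b' := (THom.delta a b b').cls
  μ_natural_left g b' := (TRel.delta_nat_left a g b').cls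
  μ_natural_right b g := (TRel.delta_nat_right a b g).cls
  associativity b b' b'' := (TRel.delta_assoc a b b' b'').cls
  left_unitality b := (TRel.delta_left a b).cls
  right_unitality b := (TRel.delta_right a b).cls
  braided b b' := (TRel.delta_symm a b b').cls

/-- `η(a) : B ⟶ A ⊗ B`, the functor `a ⊗ -` with `η(a)⁰ = β_a` and `η(a)² = δ_{a,-,-}`. -/
abbrev etaObj (B : Type u) [SmallCategory B] [MonoidalCategory B] [SymmetricCategory B] (a : A) :
    LaxBraidedFunctor B (TObj A B) :=
  ⟨etaObjFunctor B a, inferInstance⟩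

/-- `η(f) : η(a) ⟶ η(a')`, with components `f ⊗ b`. -/
def etaMap (B : Type u) [SmallCategory B] [MonoidalCategory B] [SymmetricCategory B]
    {a a' : A} (f : a ⟶ a') : etaObj B a ⟶ etaObj B a' :=
  mk₂ (fun b => (THom.mapLeft f b).cls) (fun g => (TRel.mapLeft_mapRight f g).symm.cls)
    (TRel.beta_nat f).cls (fun b b' => (TRel.delta_nat f b b').symm.cls)

@[simp] lemma app₂_etaMap {a a' : A} (f : a ⟶ a') (b : B) :
    app₂ (etaMap B f) b = (THom.mapLeft f b).cls := rfl

/-- The underlying functor of `η`. -/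
abbrev etaFunctor (A B : Type u) [SmallCategory A] [MonoidalCategory A] [SymmetricCategory A]
    [SmallCategory B] [MonoidalCategory B] [SymmetricCategory B] :
    A ⥤ LaxBraidedFunctor B (TObj A B) where
  obj a := etaObj B a
  map f := etaMap B f
  map_id a := by ext b; exact (TRel.mapLeft_id a b).cls
  map_comp f f' := by ext b; exact (TRel.mapLeft_comp f f' b).cls

/-- `η⁰ : I ⟶ η(I)`, with components `α_b`. -/
def etaε (A B : Type u) [SmallCategory A] [MonoidalCategory A] [SymmetricCategory A]
    [SmallCategory B] [MonoidalCategory B] [SymmetricCategory B] :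
    unit₁ B (TObj A B) ⟶ etaObj B (𝟙_ A) :=
  mk₂ (fun b => (THom.alpha b).cls)
    (fun g => (Category.id_comp _).trans (TRel.alpha_nat g).symm.cls)
    ((Category.id_comp _).trans TRel.beta_alpha.symm.cls)
    (fun b b' => (TRel.alpha_delta b b').cls)

/-- `η² : η(a) □ η(a') ⟶ η(a ⊗ a')`, with components `γ_{a,a',b}`. -/
def etaμ (B : Type u) [SmallCategory B] [MonoidalCategory B] [SymmetricCategory B]
    (a a' : A) : box (etaObj B a) (etaObj B a') ⟶ etaObj B (a ⊗ a') :=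
  mk₂ (fun b => (THom.gamma a a' b).cls) (fun g => (TRel.gamma_nat a a' g).cls)
    (by
      have h := (TRel.beta_gamma (B := B) a a').cls
      rw [THom.comp_cls] at h
      change ((λ_ (𝟙_ (TObj A B))).inv ≫ ((THom.beta a).cls ⊗ₘ (THom.beta a').cls)) ≫
        (THom.gamma a a' (𝟙_ B)).cls = (THom.beta (a ⊗ a')).cls
      rw [Category.assoc, Iso.inv_comp_eq]
      exact h.symm)
    (fun b b' => by
      have h : ((THom.delta a b b').cls ⊗ₘ (THom.delta a' b b').cls) ≫
          (THom.gamma a a' (b ⊗ b')).cls = tensorμ (C := TObj A B) _ _ _ _ ≫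
          ((THom.gamma a a' b).cls ⊗ₘ (THom.gamma a a' b').cls) ≫
          (THom.delta (a ⊗ a') b b').cls := (TRel.delta_gamma a a' b b').cls
      change (tensorμ (C := TObj A B) _ _ _ _ ≫
        ((THom.delta a b b').cls ⊗ₘ (THom.delta a' b b').cls)) ≫ _ = _
      erw [Category.assoc, h, ← Category.assoc, tensorμ_tensorμ, Category.id_comp]
      rfl)

@[simp] lemma app₂_etaε (b : B) : app₂ (etaε A B) b = (THom.alpha b).cls := rfl

@[simp] lemma app₂_etaμ (a a' : A) (b : B) : app₂ (etaμ B a a') b = (THom.gamma a a' b).cls := rfl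

instance etaLaxBraided : (etaFunctor A B).LaxBraided where
  ε := etaε A B
  μ a a' := etaμ B a a'
  μ_natural_left f a' := by ext b; simp; exact (TRel.gamma_nat_left f a' b).cls
  μ_natural_right a f := by ext b; simp; exact (TRel.gamma_nat_right a f b).cls
  associativity a a' a'' := by ext b; simp; exact (TRel.gamma_assoc a a' a'' b).cls
  left_unitality a := by ext b; simp; exact (TRel.gamma_left a b).cls
  right_unitality a := by ext b; simp; exact (TRel.gamma_right a b).cls
  braided a a' := by ext b; simp; exact (TRel.gamma_symm a a' b).cls

/-- The symmetric monoidal functor `η : A ⟶ [B, A ⊗ B]`. -/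
abbrev eta (A B : Type u) [SmallCategory A] [MonoidalCategory A] [SymmetricCategory A]
    [SmallCategory B] [MonoidalCategory B] [SymmetricCategory B] :
    LaxBraidedFunctor A (LaxBraidedFunctor B (TObj A B)) :=
  ⟨etaFunctor A B, inferInstance⟩

/-- `Rn = [η, 1] ∘ [B, -] : [A ⊗ B, C] ⟶ [A, [B, C]]`. -/
abbrev Rn₁ (A B C : Type u) [SmallCategory A] [MonoidalCategory A] [SymmetricCategory A]
    [SmallCategory B] [MonoidalCategory B] [SymmetricCategory B]
    [SmallCategory C] [MonoidalCategory C] [SymmetricCategory C] :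
    LaxBraidedFunctor (LaxBraidedFunctor (TObj A B) C)
      (LaxBraidedFunctor A (LaxBraidedFunctor B C)) :=
  comp₁ (post B (TObj A B) C) (pre (eta A B) (LaxBraidedFunctor B C))

end Eta

section En

variable {A B C : Type u} [SmallCategory A] [MonoidalCategory A] [SymmetricCategory A]
  [SmallCategory B] [MonoidalCategory B] [SymmetricCategory B]
  [SmallCategory C] [MonoidalCategory C] [SymmetricCategory C]

/-- `En(F)` on objects. -/
@[simp] def enObj (F : LaxBraidedFunctor A (LaxBraidedFunctor B C)) : TObj A B → C
  | .unit => 𝟙_ C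
  | .pure a b => (F.obj a).obj b
  | .tensor X Y => enObj F X ⊗ enObj F Y

/-- `En(F)` on formal arrows. -/
@[simp] def enHom (F : LaxBraidedFunctor A (LaxBraidedFunctor B C)) :
    {X Y : TObj A B} → THom A B X Y → (enObj F X ⟶ enObj F Y)
  | _, _, .id X => 𝟙 (enObj F X)
  | _, _, .comp p q => enHom F p ≫ enHom F q
  | _, _, .whiskerLeft X p => enObj F X ◁ enHom F p
  | _, _, .whiskerRight p X => enHom F p ▷ enObj F X
  | _, _, .assoc X Y Z => (α_ (enObj F X) (enObj F Y) (enObj F Z)).hom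
  | _, _, .assocInv X Y Z => (α_ (enObj F X) (enObj F Y) (enObj F Z)).inv
  | _, _, .left X => (λ_ (enObj F X)).hom
  | _, _, .leftInv X => (λ_ (enObj F X)).inv
  | _, _, .right X => (ρ_ (enObj F X)).hom
  | _, _, .rightInv X => (ρ_ (enObj F X)).inv
  | _, _, .symm X Y => (β_ (enObj F X) (enObj F Y)).hom
  | _, _, .mapRight a g => (F.obj a).map g
  | _, _, .mapLeft f b => app₂ (F.map f) b
  | _, _, .alpha b => app₂ (ε F.toFunctor) b
  | _, _, .beta a => ε (F.obj a).toFunctor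
  | _, _, .gamma a a' b => app₂ (μ F.toFunctor a a') b
  | _, _, .delta a b b' => μ (F.obj a).toFunctor b b'

lemma enHom_tensorHom (F : LaxBraidedFunctor A (LaxBraidedFunctor B C)) {X Y Z W : TObj A B}
    (p : THom A B X Y) (q : THom A B Z W) : enHom F (p.tensorHom q) = enHom F p ⊗ₘ enHom F q := by
  rw [MonoidalCategory.tensorHom_def]; rfl

lemma enHom_interchange (F : LaxBraidedFunctor A (LaxBraidedFunctor B C)) (X Y Z W : TObj A B) :
    enHom F (.interchange X Y Z W) =
      tensorμ (enObj F X) (enObj F Y) (enObj F Z) (enObj F W) := rfl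

lemma enHom_rel (F : LaxBraidedFunctor A (LaxBraidedFunctor B C)) {X Y : TObj A B}
    {p q : THom A B X Y} (h : TRel p q) : enHom F p = enHom F q := by
  induction h with
  | refl => rfl
  | symm _ ih => exact ih.symm
  | trans _ _ ih ih' => exact ih.trans ih'
  | comp _ _ ih ih' => simp [ih, ih']
  | whiskerLeft _ _ ih => simp [ih]
  | whiskerRight _ _ ih => simp [ih]
  | id_comp => simp
  | comp_id => simp
  | comp_assoc => simp
  | whiskerLeft_id => simp
  | whiskerLeft_comp => simp
  | id_whiskerRight => simp
  | comp_whiskerRight => simp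
  | exchange => simp [whisker_exchange]
  | assoc_inv => simp
  | inv_assoc => simp
  | left_inv => simp
  | inv_left => simp
  | right_inv => simp
  | inv_right => simp
  | symm_symm => simp
  | assoc_nat_left => simp
  | assoc_nat_middle => simp
  | assoc_nat_right => simp
  | left_nat => simp
  | right_nat => simp
  | symm_nat_left => simp
  | symm_nat_right => simp
  | pentagon => simp
  | triangle => simp
  | symm_left => simp
  | hexagon => simp
  | mapRight_id => simp
  | mapRight_comp => simp
  | mapLeft_id => simp
  | mapLeft_comp => simp
  | mapLeft_mapRight f g => exact (nat₂ (F.map f) g).symm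
  | alpha_nat g => 
    have h := nat₂ (ε F.toFunctor) g
    simpa using h.symm
  | beta_nat f => exact unit₂ (F.map f)
  | gamma_nat_left f a' b =>
    have h := congrArg (fun σ => app₂ σ b) (μ_natural_left F.toFunctor f a')
    simp only [app₂_comp, app₂_whiskerLeft, app₂_whiskerRight] at h
    exact h
  | gamma_nat_right a f b =>
    have h := congrArg (fun σ => app₂ σ b) (μ_natural_right F.toFunctor a f)
    simp only [app₂_comp, app₂_whiskerLeft, app₂_whiskerRight] at h
    exact h
  | gamma_nat a a' g =>
    have h := nat₂ (μ F.toFunctor a a') g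
    simpa [enHom_tensorHom] using h
  | delta_nat_left a g b' => exact μ_natural_left (F.obj a).toFunctor g b'
  | delta_nat_right a b g => exact μ_natural_right (F.obj a).toFunctor b g
  | delta_nat f b b' =>
    have h := tensor₂ (F.map f) b b'
    simpa [enHom_tensorHom] using h.symm
  | delta_assoc a b b' b'' => exact associativity (F.obj a).toFunctor b b' b''
  | delta_left a b => exact left_unitality (F.obj a).toFunctor b
  | delta_right a b => exact right_unitality (F.obj a).toFunctor b
  | delta_symm a b b' => exact Functor.LaxBraided.braided b b'
  | gamma_assoc a a' a'' b =>
    have h := congrArg (fun σ => app₂ σ b) (associativity F.toFunctor a a' a'')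
    simp only [app₂_comp, app₂_whiskerLeft, app₂_whiskerRight] at h
    exact h
  | gamma_left a b =>
    have h := congrArg (fun σ => app₂ σ b) (left_unitality F.toFunctor a)
    simp only [app₂_comp, app₂_whiskerLeft, app₂_whiskerRight] at h
    exact h
  | gamma_right a b =>
    have h := congrArg (fun σ => app₂ σ b) (right_unitality F.toFunctor a)
    simp only [app₂_comp, app₂_whiskerLeft, app₂_whiskerRight] at h
    exact h
  | gamma_symm a a' b =>
    have h := congrArg (fun σ => app₂ σ b) (Functor.LaxBraided.braided (F := F.toFunctor) a a')
    simpa using h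
  | alpha_delta b b' =>
    have h := tensor₂ (ε F.toFunctor) b b'
    simpa [enHom_tensorHom] using h
  | beta_gamma a a' =>
    have h := unit₂ (μ F.toFunctor a a')
    simp [enHom_tensorHom] at h ⊢
    rw [← h]; simp
  | beta_alpha =>
    have h := unit₂ (ε F.toFunctor)
    simpa using h.symm
  | delta_gamma a a' b b' =>
    have h := tensor₂ (μ F.toFunctor a a') b b'
    simp only [tensorObj_μ, Category.assoc] at h
    simp only [enHom, enHom_tensorHom, enHom_interchange, enObj]
    rw [← h, ← Category.assoc, tensorμ_tensorμ, Category.id_comp]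

/-- `En(F)` on arrows. -/
def enArrow (F : LaxBraidedFunctor A (LaxBraidedFunctor B C)) {X Y : TObj A B} :
    (X ⟶ Y) → (enObj F X ⟶ enObj F Y) :=
  Quotient.lift (enHom F) (fun _ _ h => enHom_rel F h)

@[simp] lemma enArrow_cls (F : LaxBraidedFunctor A (LaxBraidedFunctor B C)) {X Y : TObj A B}
    (p : THom A B X Y) : enArrow F p.cls = enHom F p := rfl

/-- The underlying functor of `En(F)`. -/
abbrev enObjFunctor (F : LaxBraidedFunctor A (LaxBraidedFunctor B C)) : TObj A B ⥤ C where
  obj := enObj F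
  map := enArrow F
  map_id _ := rfl
  map_comp f g := by
    obtain ⟨p, rfl⟩ := THom.cls_surj f
    obtain ⟨q, rfl⟩ := THom.cls_surj g
    rfl

instance enObjLaxBraided (F : LaxBraidedFunctor A (LaxBraidedFunctor B C)) :
    (enObjFunctor F).LaxBraided where
  ε := 𝟙 (𝟙_ C)
  μ X Y := 𝟙 (enObj F X ⊗ enObj F Y)
  μ_natural_left f _ := by
    obtain ⟨p, rfl⟩ := THom.cls_surj f
    exact (Category.comp_id _).trans (Category.id_comp _).symm
  μ_natural_right _ f := by
    obtain ⟨p, rfl⟩ := THom.cls_surj f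
    exact (Category.comp_id _).trans (Category.id_comp _).symm
  associativity X Y Z := by
    change (𝟙 _ ▷ _) ≫ 𝟙 _ ≫ (α_ (enObj F X) (enObj F Y) (enObj F Z)).hom =
      (α_ (enObj F X) (enObj F Y) (enObj F Z)).hom ≫ (_ ◁ 𝟙 _) ≫ 𝟙 _
    simp
  left_unitality X := by
    change _ = (𝟙 _ ▷ _) ≫ 𝟙 _ ≫ (λ_ (enObj F X)).hom
    simp
  right_unitality X := by
    change _ = (_ ◁ 𝟙 _) ≫ 𝟙 _ ≫ (ρ_ (enObj F X)).hom
    simp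
  braided X Y := (Category.id_comp _).trans (Category.comp_id _).symm

/-- The symmetric monoidal functor `En(F) : A ⊗ B ⟶ C`. -/
abbrev enObj₁ (F : LaxBraidedFunctor A (LaxBraidedFunctor B C)) :
    LaxBraidedFunctor (TObj A B) C :=
  ⟨enObjFunctor F, inferInstance⟩

/-- The components of `En(σ)`. -/
@[simp] def enApp {F G : LaxBraidedFunctor A (LaxBraidedFunctor B C)} (σ : F ⟶ G) :
    (X : TObj A B) → (enObj F X ⟶ enObj G X)
  | .unit => 𝟙 (𝟙_ C)
  | .pure a b => app₂ (app₂ σ a) b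
  | .tensor X Y => enApp σ X ⊗ₘ enApp σ Y

lemma enApp_nat {F G : LaxBraidedFunctor A (LaxBraidedFunctor B C)} (σ : F ⟶ G)
    {X Y : TObj A B} (p : THom A B X Y) :
    enHom F p ≫ enApp σ Y = enApp σ X ≫ enHom G p := by
  induction p with
  | id => simp
  | comp p q ih ih' => simp [ih', reassoc_of% ih]
  | whiskerLeft X p ih => 
    simp only [enHom, enApp, enObj, ← id_tensorHom, tensorHom_comp_tensorHom, ih,
      Category.id_comp, Category.comp_id]
  | whiskerRight p X ih => 
    simp only [enHom, enApp, enObj, ← tensorHom_id, tensorHom_comp_tensorHom, ih,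
      Category.id_comp, Category.comp_id]
  | assoc => simp
  | assocInv => simp
  | left => simp
  | leftInv => simp
  | right => simp
  | rightInv => simp
  | symm => simp
  | mapRight a g => exact nat₂ (app₂ σ a) g
  | mapLeft f b =>
    have h := congrArg (fun τ => app₂ τ b) (nat₂ σ f)
    simpa using h
  | alpha b =>
    have h := congrArg (fun τ => app₂ τ b) (unit₂ σ)
    simpa using h
  | beta a => 
    have h := unit₂ (app₂ σ a)
    simpa using h
  | gamma a a' b =>
    have h := congrArg (fun τ => app₂ τ b) (tensor₂ σ a a')
    simpa using h
  | delta a b b' => exact tensor₂ (app₂ σ a) b b'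

/-- `En(σ) : En(F) ⟶ En(G)`. -/
def enMap {F G : LaxBraidedFunctor A (LaxBraidedFunctor B C)} (σ : F ⟶ G) : enObj₁ F ⟶ enObj₁ G :=
  mk₂ (enApp σ)
    (fun f => by obtain ⟨p, rfl⟩ := THom.cls_surj f; exact enApp_nat σ p)
    (Category.id_comp _)
    (fun _ _ => (Category.id_comp _).trans (Category.comp_id _).symm)

@[simp] lemma app₂_enMap {F G : LaxBraidedFunctor A (LaxBraidedFunctor B C)} (σ : F ⟶ G)
    (X : TObj A B) : app₂ (enMap σ) X = enApp σ X := rfl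

/-- The functor `En : SMC(A, [B, C]) ⥤ SMC(A ⊗ B, C)`. -/
abbrev enFunctor (A B C : Type u) [SmallCategory A] [MonoidalCategory A] [SymmetricCategory A]
    [SmallCategory B] [MonoidalCategory B] [SymmetricCategory B]
    [SmallCategory C] [MonoidalCategory C] [SymmetricCategory C] :
    LaxBraidedFunctor A (LaxBraidedFunctor B C) ⥤ LaxBraidedFunctor (TObj A B) C where
  obj F := enObj₁ F
  map σ := enMap σ
  map_id F := by
    ext X
    rw [app₂_enMap, app₂_id]
    induction X with
    | unit => rfl
    | pure a b => simp
    | tensor X Y ih ih' => simp_all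
  map_comp σ τ := by
    ext X
    rw [app₂_comp, app₂_enMap, app₂_enMap, app₂_enMap]
    induction X with
    | unit => simp
    | pure a b => simp
    | tensor X Y ih ih' => simp [ih, ih']

end En

/-- The component at `X` of the counit `ε_F : En(Rn(F)) ⟶ F`: it is the identity on the objects
`a ⊗ b`, it is `F⁰` on the unit, and `(ε_X ⊗ ε_Y) ≫ F²_{X,Y}` on `X ⊗ Y`. -/
def counitApp {A B C : Type u} [SmallCategory A] [MonoidalCategory A] [SymmetricCategory A]
    [SmallCategory B] [MonoidalCategory B] [SymmetricCategory B]
    [SmallCategory C] [MonoidalCategory C] [SymmetricCategory C]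
    (F : LaxBraidedFunctor (TObj A B) C) :
    (X : TObj A B) → (enObj ((Rn₁ A B C).obj F) X ⟶ F.obj X)
  | .unit => ε F.toFunctor
  | .pure a b => 𝟙 (F.obj (.pure a b))
  | .tensor X Y => (counitApp F X ⊗ₘ counitApp F Y) ≫ μ F.toFunctor X Y

section Strictness

variable {A B : Type u} [SmallCategory A] [MonoidalCategory A] [SymmetricCategory A]
  [SmallCategory B] [MonoidalCategory B] [SymmetricCategory B]

/-- A symmetric monoidal functor is strict if `F⁰` and all the `F²_{a,a'}` are identities. -/
def IsStrict (F : LaxBraidedFunctor A B) : Prop :=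
  (∃ h : 𝟙_ B = F.obj (𝟙_ A), ε F.toFunctor = eqToHom h) ∧
    ∀ a a' : A, ∃ h : F.obj a ⊗ F.obj a' = F.obj (a ⊗ a'), μ F.toFunctor a a' = eqToHom h

/-- A symmetric monoidal functor is strong if `F⁰` and all the `F²_{a,a'}` are isomorphisms. -/
def IsStrong (F : LaxBraidedFunctor A B) : Prop :=
  IsIso (ε F.toFunctor) ∧ ∀ a a' : A, IsIso (μ F.toFunctor a a')

end Strictness

/-- A functor with a symmetric monoidal structure, as a 1-cell. -/
abbrev mk₁ {A B : SymMonCat.{u}} (F : A ⥤ B) (str : F.LaxBraided) : A ⟶ B :=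
  (⟨F, str⟩ : LaxBraidedFunctor A B)

/-- The internal hom `[A, B]`. -/
abbrev ihom (A B : SymMonCat.{u}) : SymMonCat.{u} := ⟨LaxBraidedFunctor A B⟩

/-- The tensor product `A ⊗ B`. -/
abbrev tensor (A B : SymMonCat.{u}) : SymMonCat.{u} := ⟨TObj A B⟩

/-- `Rn = [η, 1] ∘ [B, -] : [A ⊗ B, C] ⟶ [A, [B, C]]`. -/
abbrev Rn (A B C : SymMonCat.{u}) : ihom (tensor A B) C ⟶ ihom A (ihom B C) := Rn₁ A B C

/-- The functor `En : SMC(A, [B, C]) ⥤ SMC(A ⊗ B, C)`. -/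
abbrev En (A B C : SymMonCat.{u}) : ihom A (ihom B C) ⥤ ihom (tensor A B) C := enFunctor A B C

end SymMonCat

open SymMonCat

/-! The category `A ⊗ B` is presented by generators and relations so that a strict symmetric
monoidal functor out of it is the same thing as a symmetric monoidal functor `A ⟶ [B, C]`. A general
symmetric monoidal `F : A ⊗ B ⟶ C` is then compared with the strict functor agreeing with it on the
symbols `a ⊗ b`. The comparison is the counit `counitApp F`, which multiplies the factors of a word
together using `F⁰` and `F²`. Its naturality (`counitApp_nat`) is an induction on formal arrows:
canonical arrows are handled by the coherence axioms of `F`, and the generators `α, β, γ, δ` by the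
way `Rn` composes the structure of `η` with that of `F`. The triangle identities are inductions on
words or hold on symbols.

Strictness of `Rn` and of the unit is a matter of components. A monoidal natural transformation
whose components are all `eqToHom`s forces its source and target to be equal as symmetric monoidal
functors and is itself an `eqToHom` (`exists_eq_eqToHom₂`). Since a 2-cell into `[A, [B, C]]` has
components with components, this is applied once for `a` and once for `b`.

The passage to the 2-category is doctrinal adjunction: the lax structure of `Rn` induces by
transposition an oplax structure on `En`, and if that is invertible then `En` is strong monoidal and
the unit and counit are monoidal (`exists_laxBraided_of_isIso`). The transpose of an invertible `σ :
F ⟶ Rn(G)` is `En(σ)` followed by the counit at `G`, so it is invertible as soon as `G` is strong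
(`enMap_isIso`). The relevant `G` are `I` and `En(F) □ En(F')`. They are strong because `C` is
symmetric, so that the middle interchange is invertible. They need not be strict, so this argument
makes `En` strong rather than strict. -/

namespace SymMonCat

/-! ### Transformations determined by their components; strict and strong functors -/

section

variable {A B C : Type u} [SmallCategory A] [MonoidalCategory A] [SymmetricCategory A]
  [SmallCategory B] [MonoidalCategory B] [SymmetricCategory B]
  [SmallCategory C] [MonoidalCategory C] [SymmetricCategory C]

/-- Symmetric monoidal functors are equal if they are related by a monoidal natural
transformation with identity components, and that transformation is then an identity. -/
lemma exists_eq_eqToHom₂ {F G : LaxBraidedFunctor A B} (σ : F ⟶ G)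
    (h : ∀ a, ∃ e : F.obj a = G.obj a, app₂ σ a = eqToHom e) :
    ∃ e : F = G, σ = eqToHom e := by
  have hobj : ∀ a, F.obj a = G.obj a := fun a => (h a).1
  have happ : ∀ a, app₂ σ a = eqToHom (hobj a) := fun a => (h a).2
  have hfun : F.toFunctor = G.toFunctor := by
    refine CategoryTheory.Functor.ext hobj (fun a a' f => ?_)
    have hn := nat₂ σ f
    rw [happ, happ] at hn
    rw [← reassoc_of% hn]
    simp
  have e : F = G := by
    obtain ⟨F, i⟩ := F
    obtain ⟨G, j⟩ := G
    -- With the underlying functors identified, every component of `σ` is an identity, so its unit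
    -- and tensor axioms say exactly that the two lax structures coincide.
    obtain rfl : F = G := hfun
    refine ext₁ ?_ (fun a a' => ?_)
    · have hu := unit₂ σ
      rw [happ] at hu
      simpa using hu
    · have ht := tensor₂ σ a a'
      rw [happ, happ, happ] at ht
      simpa using ht
  refine ⟨e, ?_⟩
  ext a
  rw [happ, app₂_eqToHom]

/-- A monoidal natural transformation with invertible components is invertible. -/
lemma isIso₂ {F G : LaxBraidedFunctor A B} (σ : F ⟶ G) (h : ∀ a, IsIso (app₂ σ a)) :
    IsIso σ := by
  have : σ = (iso₂ (fun a => @asIso _ _ _ _ (app₂ σ a) (h a)) (fun f => nat₂ σ f) (unit₂ σ)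
    (tensor₂ σ)).hom := rfl
  rw [this]
  infer_instance

lemma IsStrict.isStrong {F : LaxBraidedFunctor A B} (h : IsStrict F) : IsStrong F := by
  obtain ⟨⟨e, he⟩, h⟩ := h
  refine ⟨by rw [he]; infer_instance, fun a a' => ?_⟩
  obtain ⟨e', he'⟩ := h a a'
  rw [he']
  infer_instance

/-- Symmetry makes the middle interchange its own inverse, up to swapping the two middle factors. -/
lemma isIso_tensorμ (X Y Z W : B) : IsIso (tensorμ X Y Z W) :=
  ⟨tensorμ X Z Y W, tensorμ_tensorμ _ _ _ _, tensorμ_tensorμ _ _ _ _⟩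

/-- The analogue for strict functors is not available: the structure of `F □ G` involves a unitor
and a middle interchange, which are invertible but need not be identities. This is why strong
functors enter the proof. -/
lemma IsStrong.tensor {F G : LaxBraidedFunctor A B} (hF : IsStrong F) (hG : IsStrong G) :
    IsStrong (F ⊗ G) := by
  refine ⟨?_, fun a a' => ?_⟩
  · have := hF.1
    have := hG.1
    rw [tensorObj_ε]
    infer_instance
  · have := hF.2 a a'
    have := hG.2 a a'
    have := isIso_tensorμ (F.obj a) (G.obj a) (F.obj a') (G.obj a')
    rw [tensorObj_μ]
    infer_instance

lemma isStrong_unit : IsStrong (𝟙_ (LaxBraidedFunctor A B)) :=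
  ⟨by rw [tensorUnit_ε]; infer_instance, fun a a' => by rw [tensorUnit_μ]; infer_instance⟩

/-! ### Strictness of `Rn` and of `En(F)` -/

lemma Rn₁_ε (a : A) (b : B) :
    app₂ (app₂ (ε (Rn₁ A B C).toFunctor) a) b = 𝟙 (𝟙_ C) := by
  rw [comp_ε]
  exact Category.id_comp _

lemma Rn₁_μ (F G : LaxBraidedFunctor (TObj A B) C) (a : A) (b : B) :
    app₂ (app₂ (μ (Rn₁ A B C).toFunctor F G) a) b =
      𝟙 (F.obj (.pure a b) ⊗ G.obj (.pure a b)) := by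
  rw [comp_μ]
  exact Category.id_comp _

/-- The structure arrows are 2-cells between functors into a functor category, so the component
criterion is used at both levels; at a pair `(a, b)` source and target agree by definition. -/
lemma isStrict_Rn₁ : IsStrict (Rn₁ A B C) := by
  refine ⟨exists_eq_eqToHom₂ _ fun a => exists_eq_eqToHom₂ _ fun b => ⟨rfl, Rn₁_ε a b⟩,
    fun F G => exists_eq_eqToHom₂ _ fun a => exists_eq_eqToHom₂ _ fun b => ⟨rfl, Rn₁_μ F G a b⟩⟩

lemma isStrict_enObj₁ (F : LaxBraidedFunctor A (LaxBraidedFunctor B C)) :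
    IsStrict (enObj₁ F) :=
  ⟨⟨rfl, rfl⟩, fun _ _ => ⟨rfl, rfl⟩⟩

/-! ### Lax coherence with arrows fed into each factor -/

section

variable (F : A ⥤ B) [F.LaxMonoidal] {U V W : B} {X Y Z : A} (f : U ⟶ F.obj X) (g : V ⟶ F.obj Y)
  (h : W ⟶ F.obj Z)

/-- This and the next two lemmas are the coherence axioms of `F` preceded by arbitrary arrows. With
counit components for `f`, `g`, `h`, the composites with `μ` and the factor `ε F` are the recursive
clauses of `counitApp`, so they yield naturality of the counit at the canonical arrows. -/
lemma assoc_comp_μ :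
    (α_ U V W).hom ≫ (f ⊗ₘ (g ⊗ₘ h) ≫ μ F Y Z) ≫ μ F X (Y ⊗ Z) =
      (((f ⊗ₘ g) ≫ μ F X Y ⊗ₘ h) ≫ μ F (X ⊗ Y) Z) ≫ F.map (α_ X Y Z).hom := by
  have h₁ : (f ⊗ₘ (g ⊗ₘ h) ≫ μ F Y Z) = (f ⊗ₘ (g ⊗ₘ h)) ≫ (F.obj X ◁ μ F Y Z) := by
    rw [← id_tensorHom, tensorHom_comp_tensorHom, Category.comp_id]
  have h₂ : ((f ⊗ₘ g) ≫ μ F X Y ⊗ₘ h) = ((f ⊗ₘ g) ⊗ₘ h) ≫ (μ F X Y ▷ F.obj Z) := by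
    rw [← tensorHom_id, tensorHom_comp_tensorHom, Category.comp_id]
  rw [h₁, h₂, Category.assoc, Category.assoc, Category.assoc, associativity,
    associator_naturality_assoc]

lemma left_comp_μ :
    (λ_ U).hom ≫ f = ((ε F ⊗ₘ f) ≫ μ F (𝟙_ A) X) ≫ F.map (λ_ X).hom := by
  rw [MonoidalCategory.tensorHom_def', Category.assoc, Category.assoc, ← left_unitality,
    leftUnitor_naturality]

lemma right_comp_μ :
    (ρ_ U).hom ≫ f = ((f ⊗ₘ ε F) ≫ μ F X (𝟙_ A)) ≫ F.map (ρ_ X).hom := by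
  rw [MonoidalCategory.tensorHom_def, Category.assoc, Category.assoc, ← right_unitality,
    rightUnitor_naturality]

end

/-- The formal inverses `assocInv`, `leftInv`, `rightInv` are separate constructors of `THom`; this
derives their naturality squares from those of the arrows they invert. -/
lemma inv_comp_eq_comp_map_inv (F : A ⥤ B) {U V : B} {X Y : A} {e : U ≅ V} (i : X ≅ Y)
    {f : U ⟶ F.obj X} {g : V ⟶ F.obj Y} (h : e.hom ≫ g = f ≫ F.map i.hom) :
    e.inv ≫ f = g ≫ F.map i.inv := by
  rw [Iso.inv_comp_eq, reassoc_of% h, ← F.map_comp, Iso.hom_inv_id, F.map_id, Category.comp_id]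

/-! ### The structure of `Rn(F)` and naturality of the counit -/

section Rn

variable (F : LaxBraidedFunctor (TObj A B) C)

/-- As a functor on `A`, `Rn(F)` is `η` followed by post-composition with `F`. The composite
structure therefore applies `F` to one of the generators `α, γ`, after `F⁰` or `F²`; for the
functors `Rn(F)(a)` on `B` the generators are `β, δ`. -/
lemma Rn₁_obj_ε (b : B) : app₂ (ε ((Rn₁ A B C).obj F).toFunctor) b =
    ε F.toFunctor ≫ F.map (THom.alpha b).cls := by
  change app₂ (ε ((eta A B).toFunctor ⋙ (postObj B F).toFunctor)) b = _
  rw [comp_ε]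
  rfl

lemma Rn₁_obj_μ (a a' : A) (b : B) : app₂ (μ ((Rn₁ A B C).obj F).toFunctor a a') b =
    μ F.toFunctor (.pure a b) (.pure a' b) ≫ F.map (THom.gamma a a' b).cls := by
  change app₂ (μ ((eta A B).toFunctor ⋙ (postObj B F).toFunctor) a a') b = _
  rw [comp_μ]
  rfl

lemma Rn₁_obj_obj_ε (a : A) : ε (((Rn₁ A B C).obj F).obj a).toFunctor =
    ε F.toFunctor ≫ F.map (THom.beta a).cls := by
  change ε ((etaObj B a).toFunctor ⋙ F.toFunctor) = _
  rw [comp_ε]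
  rfl

lemma Rn₁_obj_obj_μ (a : A) (b b' : B) : μ (((Rn₁ A B C).obj F).obj a).toFunctor b b' =
    μ F.toFunctor (.pure a b) (.pure a b') ≫ F.map (THom.delta a b b').cls := by
  change μ ((etaObj B a).toFunctor ⋙ F.toFunctor) b b' = _
  rw [comp_μ]
  rfl

lemma counitApp_assoc (X Y Z : TObj A B) :
    (α_ (enObj ((Rn₁ A B C).obj F) X) (enObj ((Rn₁ A B C).obj F) Y)
        (enObj ((Rn₁ A B C).obj F) Z)).hom ≫ counitApp F (X ⊗ (Y ⊗ Z)) =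
      counitApp F ((X ⊗ Y) ⊗ Z) ≫ F.map (α_ X Y Z).hom :=
  assoc_comp_μ F.toFunctor _ _ _

lemma counitApp_left (X : TObj A B) :
    (λ_ (enObj ((Rn₁ A B C).obj F) X)).hom ≫ counitApp F X =
      counitApp F (𝟙_ _ ⊗ X) ≫ F.map (λ_ X).hom :=
  left_comp_μ F.toFunctor _

lemma counitApp_right (X : TObj A B) :
    (ρ_ (enObj ((Rn₁ A B C).obj F) X)).hom ≫ counitApp F X =
      counitApp F (X ⊗ 𝟙_ _) ≫ F.map (ρ_ X).hom :=
  right_comp_μ F.toFunctor _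

/-- It suffices to treat formal arrows, since every arrow of `A ⊗ B` is a class of one. Whiskerings
use naturality of `F²`, the canonical arrows use the coherence axioms of `F`, and the symmetry uses
its braiding axiom. At the generators the components on symbols are identities, and the square
reduces to the description of the structure of `Rn(F)`. -/
lemma counitApp_nat {X Y : TObj A B} (p : THom A B X Y) :
    enHom ((Rn₁ A B C).obj F) p ≫ counitApp F Y = counitApp F X ≫ F.map p.cls := by
  induction p with
  | id X =>
    change 𝟙 _ ≫ _ = _ ≫ F.map (𝟙 X)
    simp
  | comp p q ih ih' =>
    rw [THom.comp_cls, F.map_comp, ← reassoc_of% ih, ← ih']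
    simp
  | whiskerLeft X p ih =>
    change (_ ◁ enHom _ p) ≫ (counitApp F X ⊗ₘ counitApp F _) ≫ μ F.toFunctor X _ =
      ((counitApp F X ⊗ₘ counitApp F _) ≫ μ F.toFunctor X _) ≫ F.map (X ◁ p.cls)
    rw [Category.assoc, ← μ_natural_right, ← id_tensorHom, ← id_tensorHom,
      tensorHom_comp_tensorHom_assoc, tensorHom_comp_tensorHom_assoc, ih]
    simp
  | whiskerRight p X ih =>
    change (enHom _ p ▷ _) ≫ (counitApp F _ ⊗ₘ counitApp F X) ≫ μ F.toFunctor _ X =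
      ((counitApp F _ ⊗ₘ counitApp F X) ≫ μ F.toFunctor _ X) ≫ F.map (p.cls ▷ X)
    rw [Category.assoc, ← μ_natural_left, ← tensorHom_id, ← tensorHom_id,
      tensorHom_comp_tensorHom_assoc, tensorHom_comp_tensorHom_assoc, ih]
    simp
  | assoc X Y Z => exact counitApp_assoc F X Y Z
  | assocInv X Y Z =>
    exact inv_comp_eq_comp_map_inv F.toFunctor (α_ X Y Z) (counitApp_assoc F X Y Z)
  | left X => exact counitApp_left F X
  | leftInv X =>
    exact inv_comp_eq_comp_map_inv F.toFunctor (λ_ X) (counitApp_left F X)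
  | right X => exact counitApp_right F X
  | rightInv X =>
    exact inv_comp_eq_comp_map_inv F.toFunctor (ρ_ X) (counitApp_right F X)
  | symm X Y =>
    change (β_ _ _).hom ≫ (counitApp F Y ⊗ₘ counitApp F X) ≫ μ F.toFunctor Y X =
      ((counitApp F X ⊗ₘ counitApp F Y) ≫ μ F.toFunctor X Y) ≫ F.map (β_ X Y).hom
    rw [Category.assoc, Functor.LaxBraided.braided, BraidedCategory.braiding_naturality_assoc]
  | mapRight a g => exact (Category.comp_id _).trans (Category.id_comp _).symm
  | mapLeft f b => exact (Category.comp_id _).trans (Category.id_comp _).symm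
  | alpha b => exact (Category.comp_id _).trans (Rn₁_obj_ε F b)
  | beta a => exact (Category.comp_id _).trans (Rn₁_obj_obj_ε F a)
  | gamma a a' b =>
    refine (Category.comp_id _).trans ((Rn₁_obj_μ F a a' b).trans ?_)
    simp [counitApp]
  | delta a b b' =>
    refine (Category.comp_id _).trans ((Rn₁_obj_obj_μ F a b b').trans ?_)
    simp [counitApp]

end Rn

end

/-! ### The adjunction in `Cat` -/

section

variable {A B C : Type u} [SmallCategory A] [MonoidalCategory A] [SymmetricCategory A]
  [SmallCategory B] [MonoidalCategory B] [SymmetricCategory B]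
  [SmallCategory C] [MonoidalCategory C] [SymmetricCategory C]

/-- This is the shape of the tensor axioms for `enUnit`: identity components, then the identity `μ`
of `En(F)`, then the image `f` of a generator `δ` or `γ`. -/
lemma id_tensorHom_id_comp_id_comp {X Y Z : A} (f : X ⊗ Y ⟶ Z) :
    (𝟙 X ⊗ₘ 𝟙 Y) ≫ 𝟙 (X ⊗ Y) ≫ f = f := by simp

lemma eqToHom_tensorHom_eqToHom {X X' Y Y' : A} (h : X = X') (h' : Y = Y') :
    eqToHom h ⊗ₘ eqToHom h' = eqToHom (congrArg₂ (· ⊗ ·) h h') := by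
  subst h h'; simp

/-- The counit `En(Rn(F)) ⟶ F`. -/
def enCounit (F : LaxBraidedFunctor (TObj A B) C) : enObj₁ ((Rn₁ A B C).obj F) ⟶ F :=
  mk₂ (counitApp F)
    (fun f => by obtain ⟨p, rfl⟩ := THom.cls_surj f; exact counitApp_nat F p)
    -- The source has identity structure, so the two monoidality axioms are the clauses of
    -- `counitApp` for the unit and for a tensor word.
    (Category.id_comp _) (fun _ _ => Category.id_comp _)

@[simp] lemma app₂_enCounit (F : LaxBraidedFunctor (TObj A B) C) (X : TObj A B) :
    app₂ (enCounit F) X = counitApp F X := rfl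

/-- The unit `F ⟶ Rn(En(F))`, whose components are identities. -/
def enUnit (F : LaxBraidedFunctor A (LaxBraidedFunctor B C)) : F ⟶ (Rn₁ A B C).obj (enObj₁ F) :=
  mk₂ (fun a => mk₂ (fun b => 𝟙 ((F.obj a).obj b))
      (fun g => (Category.comp_id _).trans (Category.id_comp _).symm)
      (by
        rw [Rn₁_obj_obj_ε]
        exact (Category.comp_id _).trans (Category.id_comp _).symm)
      (fun b b' => by
        rw [Rn₁_obj_obj_μ]
        exact (Category.comp_id _).trans (id_tensorHom_id_comp_id_comp _).symm))
    (fun f => by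
      ext b
      exact (Category.comp_id _).trans (Category.id_comp _).symm)
    (by
      ext b
      rw [Rn₁_obj_ε]
      exact (Category.comp_id _).trans (Category.id_comp _).symm)
    (fun a a' => by
      ext b
      rw [app₂_comp, app₂_comp, Rn₁_obj_μ]
      exact (Category.comp_id _).trans (id_tensorHom_id_comp_id_comp _).symm)

@[simp] lemma app₂_enUnit (F : LaxBraidedFunctor A (LaxBraidedFunctor B C)) (a : A) (b : B) :
    app₂ (app₂ (enUnit F) a) b = 𝟙 ((F.obj a).obj b) := rfl

/-- By induction on words: the unit and tensor clauses are the two monoidality axioms of `σ`, and on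
symbols both counit components are identities. -/
lemma enCounit_nat {F G : LaxBraidedFunctor (TObj A B) C} (σ : F ⟶ G) :
    enMap ((Rn₁ A B C).map σ) ≫ enCounit G = enCounit F ≫ σ := by
  ext X
  rw [app₂_comp, app₂_comp, app₂_enMap, app₂_enCounit, app₂_enCounit]
  induction X with
  | unit => exact (Category.id_comp _).trans (unit₂ σ).symm
  | pure a b => exact (Category.comp_id _).trans (Category.id_comp _).symm
  | tensor X Y ih ih' =>
    change (_ ⊗ₘ _) ≫ (_ ⊗ₘ _) ≫ μ G.toFunctor X Y =
      ((counitApp F X ⊗ₘ counitApp F Y) ≫ μ F.toFunctor X Y) ≫ app₂ σ (X ⊗ Y)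
    rw [tensorHom_comp_tensorHom_assoc, ih, ih', Category.assoc, tensor₂,
      tensorHom_comp_tensorHom_assoc]

/-- The adjunction `En ⊣ Rn` in `Cat`. -/
def enAdjunction (A B C : Type u) [SmallCategory A] [MonoidalCategory A] [SymmetricCategory A]
    [SmallCategory B] [MonoidalCategory B] [SymmetricCategory B]
    [SmallCategory C] [MonoidalCategory C] [SymmetricCategory C] :
    enFunctor A B C ⊣ (Rn₁ A B C).toFunctor where
  unit :=
    { app := enUnit
      naturality := fun F G σ => by
        ext a b
        exact (Category.comp_id _).trans (Category.id_comp _).symm }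
  counit :=
    { app := enCounit
      naturality := fun F G σ => enCounit_nat σ }
  left_triangle_components F := by
    ext X
    -- Both factors are built by recursion from identities, the `μ` of `En(F)` being one too, so
    -- induction on the word suffices.
    change enApp (enUnit F) X ≫ counitApp (enObj₁ F) X = 𝟙 (enObj F X)
    induction X with
    | unit => exact Category.id_comp _
    | pure a b => exact Category.id_comp _
    | tensor X Y ih ih' =>
      change (_ ⊗ₘ _) ≫ (_ ⊗ₘ _) ≫ 𝟙 _ = 𝟙 (enObj F X ⊗ enObj F Y)
      rw [tensorHom_comp_tensorHom_assoc, ih, ih', Category.comp_id, id_tensorHom_id]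
  right_triangle_components F := by
    ext a b
    -- `Rn` only evaluates at symbols `a ⊗ b`, where the counit is an identity.
    exact Category.id_comp _

/-- On objects this is the clause of `enObj` for symbols; equality of the remaining data, including
both levels of lax structure, comes from `enUnit` being a monoidal natural transformation at both
levels. -/
lemma enUnit_eq (F : LaxBraidedFunctor A (LaxBraidedFunctor B C)) :
    ∃ e : F = (Rn₁ A B C).obj (enObj₁ F), enUnit F = eqToHom e :=
  exists_eq_eqToHom₂ _ fun a => exists_eq_eqToHom₂ _ fun b => ⟨rfl, rfl⟩

/-- Words are evaluated through `F⁰` and `F²` only, so the counit inherits from them the property of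
being an `eqToHom`. Equality of objects and of components has to be proved in the same induction, as
the latter is only stated by means of the former. -/
lemma enCounit_eq {F : LaxBraidedFunctor (TObj A B) C} (hF : IsStrict F) :
    ∃ e : enObj₁ ((Rn₁ A B C).obj F) = F, enCounit F = eqToHom e := by
  refine exists_eq_eqToHom₂ _ fun X => ?_
  change ∃ e : enObj ((Rn₁ A B C).obj F) X = F.obj X, counitApp F X = eqToHom e
  induction X with
  | unit => exact hF.1
  | pure a b => exact ⟨rfl, rfl⟩
  | tensor X Y ih ih' =>
    obtain ⟨e, h⟩ := ih
    obtain ⟨e', h'⟩ := ih'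
    obtain ⟨e'', h''⟩ := hF.2 X Y
    refine ⟨(congrArg₂ (· ⊗ ·) e e').trans e'', ?_⟩
    change (counitApp F X ⊗ₘ counitApp F Y) ≫ μ F.toFunctor X Y = _
    rw [h, h', h'', eqToHom_tensorHom_eqToHom, eqToHom_trans]
    rfl

/-- The same induction as in the strict case, now with invertibility, which tensoring and
composition preserve. -/
lemma isIso_enCounit {F : LaxBraidedFunctor (TObj A B) C} (hF : IsStrong F) :
    IsIso (enCounit F) := by
  refine isIso₂ _ fun X => ?_
  change IsIso (counitApp F X)
  induction X with
  | unit => exact hF.1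
  | pure a b => exact inferInstanceAs (IsIso (𝟙 _))
  | tensor X Y ih ih' =>
    have := hF.2 X Y
    exact inferInstanceAs (IsIso ((counitApp F X ⊗ₘ counitApp F Y) ≫ μ F.toFunctor X Y))

/-- A natural transformation whose components are identities is an identity. -/
lemma exists_eq_eqToHom_of_app {D E : Type*} [Category* D] [Category* E] {F G : D ⥤ E}
    (σ : F ⟶ G) (h : ∀ X, ∃ e : F.obj X = G.obj X, σ.app X = eqToHom e) :
    ∃ e : F = G, σ = eqToHom e := by
  have happ : ∀ X, σ.app X = eqToHom (h X).1 := fun X => (h X).2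
  have e : F = G := by
    refine CategoryTheory.Functor.ext (fun X => (h X).1) (fun X Y f => ?_)
    have hn := σ.naturality f
    rw [happ, happ] at hn
    rw [← reassoc_of% hn]
    simp
  refine ⟨e, ?_⟩
  ext X
  rw [happ, eqToHom_app]

end

/-! ### Doctrinal adjunction for symmetric monoidal functors -/

section

variable {D E : Type*} [Category* D] [MonoidalCategory D] [SymmetricCategory D]
  [Category* E] [MonoidalCategory E] [SymmetricCategory E] {L : D ⥤ E} {R : E ⥤ D}

open Functor.OplaxMonoidal in
/-- A left adjoint of a symmetric lax monoidal functor is symmetric if the induced oplax monoidal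
structure is invertible. -/
lemma braiding_comp_δ (adj : L ⊣ R) [R.LaxBraided] [L.OplaxMonoidal] [adj.IsMonoidal] (X Y : D) :
    L.map (β_ X Y).hom ≫ δ L Y X = δ L X Y ≫ (β_ (L.obj X) (L.obj Y)).hom := by
  apply (adj.homEquiv _ _).injective
  simp only [Adjunction.homEquiv_unit, Functor.map_comp]
  -- After transposition `δ` turns into `(unit ⊗ unit) ≫ μ R`, so the claim becomes naturality of
  -- the symmetry together with the braiding axiom of `R`.
  rw [adj.unit_naturality_assoc, adj.unit_app_tensor_comp_map_δ, adj.unit_app_tensor_comp_map_δ_assoc,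
    Functor.LaxBraided.braided]
  simp

/-- Only the compatibility of `μ` with the symmetry has to be added. Since `μ` inverts `δ`, it
follows from the corresponding statement for `δ`. -/
lemma exists_laxBraided_of_isMonoidal (adj : L ⊣ R) [R.LaxBraided] [L.Monoidal]
    [adj.IsMonoidal] :
    ∃ _ : L.LaxBraided, NatTrans.IsMonoidal adj.unit ∧ NatTrans.IsMonoidal adj.counit := by
  have hβ : ∀ X Y, μ L X Y ≫ L.map (β_ X Y).hom = (β_ (L.obj X) (L.obj Y)).hom ≫ μ L Y X := by
    intro X Y
    rw [← cancel_epi (Functor.OplaxMonoidal.δ L X Y),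
      ← cancel_mono (Functor.OplaxMonoidal.δ L Y X)]
    simpa using braiding_comp_δ adj X Y
  exact ⟨{ braided := hβ }, inferInstanceAs (NatTrans.IsMonoidal adj.unit),
    inferInstanceAs (NatTrans.IsMonoidal adj.counit)⟩

/-- The two hypotheses speak of the transposes that form the canonical oplax structure of `L`; their
inverses are the required lax structure. -/
lemma exists_laxBraided_of_isIso (adj : L ⊣ R) [R.LaxBraided]
    (hη : IsIso ((adj.homEquiv _ _).symm (ε R)))
    (hδ : ∀ X Y, IsIso ((adj.homEquiv _ _).symm ((adj.unit.app X ⊗ₘ adj.unit.app Y) ≫ μ R _ _))) :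
    ∃ _ : L.LaxBraided, NatTrans.IsMonoidal adj.unit ∧ NatTrans.IsMonoidal adj.counit := by
  let : L.OplaxMonoidal := adj.leftAdjointOplaxMonoidal
  have : IsIso (Functor.OplaxMonoidal.η L) := hη
  have : ∀ X Y, IsIso (Functor.OplaxMonoidal.δ L X Y) := hδ
  have h : adj.IsMonoidal := inferInstance
  let i : L.Monoidal := Functor.Monoidal.ofOplaxMonoidal L
  -- The oplax part of `i` has the original `η` and `δ`, so the compatibility proofs carry over
  -- unchanged.
  have : @Adjunction.IsMonoidal _ _ _ _ _ _ _ _ adj i.toOplaxMonoidal _ :=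
    @Adjunction.IsMonoidal.mk _ _ _ _ _ _ _ _ adj i.toOplaxMonoidal _
      h.leftAdjoint_ε h.leftAdjoint_μ
  exact exists_laxBraided_of_isMonoidal adj

end

/-! ### The adjunction in the 2-category of symmetric monoidal categories -/

section

variable {A B C : Type u} [SmallCategory A] [MonoidalCategory A] [SymmetricCategory A]
  [SmallCategory B] [MonoidalCategory B] [SymmetricCategory B]
  [SmallCategory C] [MonoidalCategory C] [SymmetricCategory C]

/-- The transpose is `En(σ)` followed by the counit at `G`, and the latter is invertible for strong
`G`. Both oplax structure arrows of `En` have this form. -/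
lemma enMap_isIso {F : LaxBraidedFunctor A (LaxBraidedFunctor B C)}
    {G : LaxBraidedFunctor (TObj A B) C} (σ : F ⟶ (Rn₁ A B C).obj G) [IsIso σ] (hG : IsStrong G) :
    IsIso (((enAdjunction A B C).homEquiv F G).symm σ) := by
  have := isIso_enCounit hG
  have : IsIso ((enAdjunction A B C).counit.app G) := this
  have : IsIso ((enFunctor A B C).map σ) := Functor.map_isIso _ σ
  rw [Adjunction.homEquiv_counit]
  exact IsIso.comp_isIso

lemma isIso_of_eqToHom {D : Type*} [Category* D] {X Y : D} {f : X ⟶ Y}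
    (h : ∃ e : X = Y, f = eqToHom e) : IsIso f := by
  obtain ⟨e, rfl⟩ := h
  infer_instance

/-- The arrows to be transposed are built from the structure of `Rn` and the unit, all invertible
because they are `eqToHom`s; the targets `I` and `En(F) □ En(G)` are strong. -/
lemma exists_laxBraided_en : ∃ _ : (enFunctor A B C).LaxBraided,
    NatTrans.IsMonoidal (enAdjunction A B C).unit ∧
      NatTrans.IsMonoidal (enAdjunction A B C).counit := by
  refine exists_laxBraided_of_isIso _ ?_ fun F G => ?_
  · have : IsIso (ε (Rn₁ A B C).toFunctor) := isIso_of_eqToHom isStrict_Rn₁.1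
    exact enMap_isIso (ε (Rn₁ A B C).toFunctor) isStrong_unit
  · have : IsIso (μ (Rn₁ A B C).toFunctor (enObj₁ F) (enObj₁ G)) :=
      isIso_of_eqToHom (isStrict_Rn₁.2 _ _)
    have : IsIso ((enAdjunction A B C).unit.app F) := isIso_of_eqToHom (enUnit_eq F)
    have : IsIso ((enAdjunction A B C).unit.app G) := isIso_of_eqToHom (enUnit_eq G)
    exact enMap_isIso (((enAdjunction A B C).unit.app F ⊗ₘ (enAdjunction A B C).unit.app G) ≫
      μ (Rn₁ A B C).toFunctor (enObj₁ F) (enObj₁ G))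
      ((isStrict_enObj₁ F).isStrong.tensor (isStrict_enObj₁ G).isStrong)

section

variable {D : Type*} [Bicategory D] {a b : D} {f : a ⟶ b} {g : b ⟶ a} (η : 𝟙 a ⟶ f ≫ g)
  (ε : g ≫ f ⟶ 𝟙 b)

/-- Makes the hidden associator explicit, so that the components of the zigzag can be read off;
likewise for the right zigzag. -/
lemma leftZigzag_eq : Bicategory.leftZigzag η ε =
    Bicategory.whiskerRight η f ≫ (Bicategory.associator f g f).hom ≫
      Bicategory.whiskerLeft f ε := by
  simp [Bicategory.leftZigzag, bicategoricalComp]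

lemma rightZigzag_eq : Bicategory.rightZigzag η ε =
    Bicategory.whiskerLeft g η ≫ (Bicategory.associator g f g).inv ≫
      Bicategory.whiskerRight ε g := by
  simp [Bicategory.rightZigzag, bicategoricalComp]

end

/-- An adjunction whose unit and counit are monoidal is an adjunction in the 2-category of
symmetric monoidal categories. -/
def bicategoryAdjunction {A B : SymMonCat.{u}} {L : A ⟶ B} {R : B ⟶ A}
    (adj : (L : LaxBraidedFunctor A B).toFunctor ⊣ (R : LaxBraidedFunctor B A).toFunctor)
    (hunit : NatTrans.IsMonoidal adj.unit) (hcounit : NatTrans.IsMonoidal adj.counit) :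
    Bicategory.Adjunction L R where
  unit := (LaxBraidedFunctor.homMk adj.unit :
    id₁ A ⟶ comp₁ (A := A) (B := B) (C := A) L R)
  counit := (LaxBraidedFunctor.homMk adj.counit :
    comp₁ (A := B) (B := A) (C := B) R L ⟶ id₁ B)
  left_triangle := by
    rw [leftZigzag_eq]
    apply ext₂
    intro a
    -- Associators and unitors of this 2-category have identity components, so each triangle differs
    -- from the one in `Cat` only by composition with identities.
    refine Eq.trans ?_ ((adj.left_triangle_components a).trans (Category.comp_id _).symm)
    exact congrArg (L.map (adj.unit.app a) ≫ ·) (Category.id_comp (adj.counit.app (L.obj a)))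
  right_triangle := by
    rw [rightZigzag_eq]
    apply ext₂
    intro b
    refine Eq.trans ?_ ((adj.right_triangle_components b).trans (Category.comp_id _).symm)
    exact congrArg (adj.unit.app (R.obj b) ≫ ·) (Category.id_comp (R.map (adj.counit.app b)))

end

end SymMonCat

theorem mainTheorem5 (A B C : SymMonCat.{u}) :
    -- `Rn` is strict
    IsStrict (Rn A B C) ∧
    -- the adjunction `En ⊣ Rn` in `Cat`, with identity unit and with counit `ε`
    ∃ adj₀ : En A B C ⊣ (Rn A B C).toFunctor,
      (∃ h : 𝟭 (ihom A (ihom B C)) = En A B C ⋙ (Rn A B C).toFunctor, adj₀.unit = eqToHom h) ∧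
      (∀ (F : ihom (tensor A B) C) (X : tensor A B),
        app₂ (adj₀.counit.app F) X = counitApp F X) ∧
      (∀ F : ihom (tensor A B) C, IsStrict F →
        ∃ h : (En A B C).obj ((Rn A B C).obj F) = F, adj₀.counit.app F = eqToHom h) ∧
      (∀ F : ihom (tensor A B) C, IsStrong F → IsIso (adj₀.counit.app F)) ∧
      -- it underlies an adjunction in the 2-category of symmetric monoidal categories
      ∃ (str : (En A B C).LaxBraided)
        (adj : Bicategory.Adjunction (mk₁ (En A B C) str) (Rn A B C)),
        (∃ h : 𝟙 (ihom A (ihom B C)) = mk₁ (En A B C) str ≫ Rn A B C,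
          adj.unit = eqToHom h) ∧
        (∀ F : ihom A (ihom B C), app₂ adj.unit F = adj₀.unit.app F) ∧
        (∀ F : ihom (tensor A B) C, app₂ adj.counit F = adj₀.counit.app F) := by
  obtain ⟨str, hunit, hcounit⟩ := exists_laxBraided_en (A := A) (B := B) (C := C)
  refine ⟨isStrict_Rn₁, enAdjunction A B C, exists_eq_eqToHom_of_app _ enUnit_eq,
    fun _ _ => rfl, fun F hF => enCounit_eq hF, fun F hF => isIso_enCounit hF, str,
    bicategoryAdjunction (L := mk₁ (En A B C) str) (R := Rn A B C) (enAdjunction A B C)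
      hunit hcounit, ?_, fun _ => rfl, fun _ => rfl⟩
  -- The unit is monoidal for the chosen structure on `En`, and its components are `eqToHom`s. The
  -- component criterion, now for functors on `[A, [B, C]]`, thus also shows that the lax structure
  -- of the composite `Rn ∘ En` is the identity one.
  exact exists_eq_eqToHom₂ (F := id₁ _) (G := comp₁ (mk₁ (En A B C) str) (Rn A B C)) _ enUnit_eq
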